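/- Let $d(n)=\sum_{d\mid n}1$ be the divisor function, let $\gamma$ be Euler's constant, let $B_n$ be the Bernoulli numbers, let $\epsilon=e^{i\pi/4}$, and let $K_0$ be the modified Bessel function of the second kind of order $0$, i.e. $K_0(z)=\int_0^\infty e^{-z\cosh t}\,dt$ for $\operatorname{Re} z>0$. For real $\rho>0$ and $x>0$ let $$\Omega_\rho(x)=2\sum_{j=1}^\infty d(j)\left(K_0\!\left(4\rho\epsilon\sqrt{jx}\right)+K_0\!\left(4\rho\overline{\epsilon}\sqrt{jx}\right)\right),$$ the generalized Koshliakov function. Let $m$ be a non-zero integer and let $\alpha,\beta>0$ with $\alpha\beta=\pi^2$. Then $\zeta(2m+1)\neq 0$; for all $\rho>0$ and $x>0$ the series defining $\Omega_\rho(x)$ and the series $\sum_{n\ge1} d(n)\Omega_\rho(n)n^{-2m-1}$ converge absolutely; and $$\begin{aligned} &\alpha^{-2m}\left[\zeta^2(2m+1)\left(\gamma+\log\frac{\alpha}{\pi}-\frac{\zeta'(2m+1)}{\zeta(2m+1)}\right)+\sum_{n=1}^\infty\frac{d(n)\,\Omega_\alpha(n)}{n^{2m+1}}\right]\\ &\quad=(-1)^{-m}\beta^{-2m}\left[\zeta^2(2m+1)\left(\gamma+\log\frac{\beta}{\pi}-\frac{\zeta'(2m+1)}{\zeta(2m+1)}\right)+\sum_{n=1}^\infty\frac{d(n)\,\Omega_\beta(n)}{n^{2m+1}}\right]\\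 &\qquad-2^{4m}\pi\sum_{j=0}^{m+1}\frac{(-1)^jB_{2j}^2\,B_{2m+2-2j}^2}{(2j)!^2\,(2m+2-2j)!^2}\,\alpha^{2j}\beta^{2m+2-2j}, \end{aligned}$$ where the last sum is empty if $m\le-2$. -/

import Mathlib

noncomputable section

/-- The modified Bessel function of the second kind `K_ν(z)`, `Re z > 0`, through Schläfli's
integral `K_ν(z) = ∫₀^∞ exp(-z cosh t) cosh(ν t) dt`. (For `Re z ≤ 0` the integral diverges and
the value is not used.) -/
def besselK (ν z : ℂ) : ℂ :=
  ∫ t in Set.Ioi (0 : ℝ), Complex.exp (-z * Complex.cosh t) * Complex.cosh (ν * t)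

/-- The divisor function `d(n) = ∑_{d ∣ n} 1`. -/
def divisorCount (n : ℕ) : ℕ := ∑ _d ∈ n.divisors, 1

/-- `ε = exp(iπ/4)`. -/
def koshliakovEps : ℂ := Complex.exp (Complex.I * Real.pi / 4)

/-- The `j`-th term `d(j) (K₀(4ρε√(jx)) + K₀(4ρε̄√(jx)))` of the series of `Ω_ρ(x)`. -/
def koshliakovTerm (ρ x : ℝ) (j : ℕ+) : ℂ :=
  (divisorCount j : ℂ) *
    (besselK 0 (4 * (ρ : ℂ) * koshliakovEps * (Real.sqrt ((j : ℝ) * x) : ℂ)) +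
      besselK 0 (4 * (ρ : ℂ) * (starRingEnd ℂ) koshliakovEps * (Real.sqrt ((j : ℝ) * x) : ℂ)))

/-- The generalized Koshliakov function
`Ω_ρ(x) = 2 ∑_{j ≥ 1} d(j) (K₀(4ρε√(jx)) + K₀(4ρε̄√(jx)))`, for `ρ, x > 0`. -/
def koshliakovOmega (ρ x : ℝ) : ℂ := 2 * ∑' j : ℕ+, koshliakovTerm ρ x j

/-- The `n`-th term `d(n) Ω_ρ(n) / n^(2m+1)` of the series in the transformation formula. -/
def dixitGuptaTerm (m : ℤ) (ρ : ℝ) (n : ℕ+) : ℂ :=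
  (divisorCount n : ℂ) * koshliakovOmega ρ (n : ℝ) / ((n : ℕ) : ℂ) ^ (2 * m + 1)

/-- The bracket
`ζ²(2m+1) (γ + log(ρ/π) - ζ'(2m+1)/ζ(2m+1)) + ∑_{n ≥ 1} d(n) Ω_ρ(n) / n^(2m+1)`. -/
def dixitGuptaBracket (m : ℤ) (ρ : ℝ) : ℂ :=
  riemannZeta (2 * (m : ℂ) + 1) ^ 2 *
      ((Real.eulerMascheroniConstant : ℂ) + (Real.log (ρ / Real.pi) : ℂ) -
        deriv riemannZeta (2 * (m : ℂ) + 1) / riemannZeta (2 * (m : ℂ) + 1)) +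
    ∑' n : ℕ+, dixitGuptaTerm m ρ n

/-- The `j`-th summand
`(-1)^j B_{2j}² B_{2m+2-2j}² / ((2j)!² (2m+2-2j)!²) α^{2j} β^{2m+2-2j}`, for `0 ≤ j ≤ m + 1`. -/
def dixitGuptaFiniteTerm (m : ℤ) (α β : ℝ) (j : ℕ) : ℝ :=
  (-1) ^ j * (bernoulli (2 * j) : ℝ) ^ 2 *
      (bernoulli (2 * m + 2 - 2 * (j : ℤ)).toNat : ℝ) ^ 2 /
    (((2 * j).factorial : ℝ) ^ 2 * ((2 * m + 2 - 2 * (j : ℤ)).toNat.factorial : ℝ) ^ 2) *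
    α ^ (2 * j) * β ^ (2 * m + 2 - 2 * (j : ℤ))

end

/-! Both sides come from one contour integral with a reflection symmetry. The Mellin transform of `X
↦ K₀(4πε√X) + K₀(4πε̄√X)` is `(2π)^(-2w) Γ(w)² cos(πw/2)` (`mellin_koshliakovKernel`). Multiplied by
`2 ζ(w)²`, it becomes `ζ(1-w)² / (2 cos(πw/2))` by the functional equation. Mellin inversion and
summation against `d(n) d(j)` therefore turn `∑ d(n) Ω_ρ(n) n^(-2m-1)` into `1/(2πi)` times the
integral of `ζ(1-w)² ζ(w+2m+1)² λ^(-w) / (2 cos(πw/2))`, with `λ = ρ²/π²`, over a line far to the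
right (`hasSum_dixitGuptaTerm`).

The substitution `w ↦ -2m - w` exchanges the two zeta factors, replaces `λ` by `1/λ`, and multiplies
by `(-1)^m λ^(2m)` (`spectralIntegral_reflect`). Since `αβ = π²`, the values of `λ` for `α` and `β`
are `α/β` and its inverse. So the `α`-series on the line `Re w = c` and the `β`-series on the
reflected line `Re w = -2m - c` differ only by residues.

The double poles at `0` and `-2m` give the terms with `γ`, the logarithms and `ζ'/ζ`
(`spectralIntegral_sub_zero`, `spectralIntegral_sub_neg_two_mul`). The zeros of the cosine at odd
integers give simple poles. Trivial zeros of zeta cancel all of these except at the odd `p` with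
`-2m-1 ≤ p ≤ 1`, where both zeta values are at even nonnegative integers and Euler's formula
produces the Bernoulli sum (`oddResidue_eq_zero`, `oddResidue_eq_finiteTerm`).

The analysis rests on two bounds: zeta grows at most polynomially in vertical strips
(`exists_norm_riemannZeta₁_le_pow`), while `1/cos` decays faster than any power. The contour is
moved one integer at a time between half-integer abscissas
(`integral_vertical_sub_integral_vertical`), and the differences telescope. -/

/-! ### Polynomial growth of zeta in vertical strips -/

/-- The binomial coefficient `a (a - 1) ⋯ (a - i + 1) / i!`. -/
noncomputable def cbinom (a : ℂ) (i : ℕ) : ℂ := (∏ l ∈ Finset.range i, (a - l)) / (i.factorial : ℂ)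

lemma cbinom_zero (a : ℂ) : cbinom a 0 = 1 := by simp [cbinom]

lemma cbinom_one (a : ℂ) : cbinom a 1 = a := by simp [cbinom]

lemma succ_mul_cbinom_succ (a : ℂ) (i : ℕ) :
    ((i : ℂ) + 1) * cbinom a (i + 1) = a * cbinom (a - 1) i := by
  have h1 : ((i : ℂ) + 1) ≠ 0 := Nat.cast_add_one_ne_zero i
  have h2 : (i.factorial : ℂ) ≠ 0 := Nat.cast_ne_zero.2 i.factorial_ne_zero
  have h3 : ∏ l ∈ Finset.range i, (a - ((l + 1 : ℕ) : ℂ)) =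
      ∏ l ∈ Finset.range i, (a - 1 - l) :=
    Finset.prod_congr rfl fun l _ => by push_cast; ring
  rw [cbinom, cbinom, Finset.prod_range_succ', h3, Nat.factorial_succ]
  push_cast
  field_simp
  ring

lemma cbinom_succ (a : ℂ) (i : ℕ) :
    ((i : ℂ) + 1) * cbinom a (i + 1) = (a - i) * cbinom a i := by
  have h1 : ((i : ℂ) + 1) ≠ 0 := Nat.cast_add_one_ne_zero i
  have h2 : (i.factorial : ℂ) ≠ 0 := Nat.cast_ne_zero.2 i.factorial_ne_zero
  rw [cbinom, cbinom, Finset.prod_range_succ, Nat.factorial_succ]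
  push_cast
  field_simp

lemma norm_cbinom_le (a : ℂ) (i : ℕ) : ‖cbinom a i‖ ≤ (‖a‖ + i) ^ i := by
  rw [cbinom, norm_div, norm_prod, Complex.norm_natCast]
  refine (div_le_self (Finset.prod_nonneg fun _ _ => norm_nonneg _)
    (by exact_mod_cast i.factorial_pos)).trans ?_
  calc _ ≤ ∏ _l ∈ Finset.range i, (‖a‖ + i) := by
        refine Finset.prod_le_prod (fun _ _ => norm_nonneg _) fun l hl => ?_
        refine (norm_sub_le _ _).trans ?_
        rw [Complex.norm_natCast]
        gcongr
        exact (Finset.mem_range.1 hl).le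
    _ = _ := by simp

lemma differentiable_cbinom (i : ℕ) : Differentiable ℂ fun a => cbinom a i := by
  unfold cbinom
  fun_prop

/-- Remainder of the binomial series after `M` terms. -/
noncomputable def binomRem (M : ℕ) (a : ℂ) (x : ℝ) : ℂ :=
  (1 + (x : ℂ)) ^ a - ∑ i ∈ Finset.range M, cbinom a i * (x : ℂ) ^ i

/-- Differentiation lowers both the exponent and the number of subtracted terms by one, by the
absorption identity for binomial coefficients. This drives the induction in `norm_binomRem_le`. -/
lemma hasDerivAt_binomRem_succ (M : ℕ) (a : ℂ) {x : ℝ} (hx : 0 ≤ x) :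
    HasDerivAt (binomRem (M + 1) a) (a * binomRem M (a - 1) x) x := by
  have h1 : HasDerivAt (fun z : ℂ => (1 + z) ^ a) (a * (1 + (x : ℂ)) ^ (a - 1) * 1) x :=
    ((hasDerivAt_id (x : ℂ)).const_add 1).cpow_const (by
      left; simp; linarith)
  have h2 : HasDerivAt (fun z : ℂ => ∑ i ∈ Finset.range (M + 1), cbinom a i * z ^ i)
      (∑ i ∈ Finset.range (M + 1), cbinom a i * (i * (x : ℂ) ^ (i - 1))) x :=
    HasDerivAt.fun_sum fun i _ => (hasDerivAt_pow i (x : ℂ)).const_mul _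
  have h : HasDerivAt (binomRem (M + 1) a) _ x := (h1.sub h2).comp_ofReal
  convert h using 1
  rw [Finset.sum_range_succ', binomRem, mul_sub, Finset.mul_sum]
  simp only [Nat.cast_zero, zero_mul, mul_zero, add_zero, mul_one, Nat.add_sub_cancel]
  congr 1
  refine Finset.sum_congr rfl fun i _ => ?_
  have := succ_mul_cbinom_succ a i
  push_cast
  linear_combination (-(x : ℂ) ^ i) * this

/-- Induction through the mean value inequality on `[0, x]`: the remainder vanishes at `0` and its
derivative is a remainder of lower order. The `+ M` in the exponent of `2` absorbs the passage from
`a` to `a - 1`. -/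
lemma norm_binomRem_le (M : ℕ) : ∀ (a : ℂ) (x : ℝ), 0 ≤ x → x ≤ 1 →
    ‖binomRem M a x‖ ≤
      (∏ l ∈ Finset.range M, ‖a - l‖) * (2 : ℝ) ^ (|a.re| + M) * x ^ M := by
  induction M with
  | zero =>
    intro a x hx hx1
    have h : (1 + (x : ℂ)) = ((1 + x : ℝ) : ℂ) := by push_cast; rfl
    simp only [binomRem, Finset.range_zero, Finset.sum_empty, sub_zero, Finset.prod_empty, one_mul,
      pow_zero, mul_one, Nat.cast_zero, add_zero]
    rw [h, Complex.norm_cpow_eq_rpow_re_of_pos (by linarith)]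
    calc (1 + x) ^ a.re ≤ (1 + x) ^ |a.re| :=
          Real.rpow_le_rpow_of_exponent_le (by linarith) (le_abs_self _)
      _ ≤ 2 ^ |a.re| := Real.rpow_le_rpow (by linarith) (by linarith) (abs_nonneg _)
  | succ M ih =>
    intro a x hx hx1
    have h0 : binomRem (M + 1) a 0 = 0 := by
      rw [binomRem, Finset.sum_range_succ']
      simp [cbinom_zero]
    have hP : ∏ l ∈ Finset.range (M + 1), ‖a - l‖ =
        ‖a‖ * ∏ l ∈ Finset.range M, ‖a - 1 - l‖ := by
      rw [Finset.prod_range_succ', mul_comm]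
      congr 1
      · simp
      · exact Finset.prod_congr rfl fun l _ => by push_cast; congr 1; ring
    have hP0 : 0 ≤ ∏ l ∈ Finset.range M, ‖a - 1 - l‖ := Finset.prod_nonneg fun _ _ => norm_nonneg _
    have key := norm_image_sub_le_of_norm_deriv_le_segment' (f := binomRem (M + 1) a)
      (f' := fun y => a * binomRem M (a - 1) y) (a := 0) (b := x)
      (C := (∏ l ∈ Finset.range (M + 1), ‖a - l‖) * (2 : ℝ) ^ (|a.re| + (M + 1 : ℕ)) * x ^ M)
      (fun y hy => (hasDerivAt_binomRem_succ M a hy.1).hasDerivWithinAt)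
      (fun y hy => by
        rw [norm_mul, hP]
        have h1 := ih (a - 1) y hy.1 (hy.2.le.trans hx1)
        have h2 : (2 : ℝ) ^ (|(a - 1).re| + M) ≤ 2 ^ (|a.re| + (M + 1 : ℕ)) := by
          refine Real.rpow_le_rpow_of_exponent_le one_le_two ?_
          have : |(a - 1).re| ≤ |a.re| + 1 := by
            simpa using abs_sub a.re 1
          push_cast
          linarith
        have h3 : y ^ M ≤ x ^ M := pow_le_pow_left₀ hy.1 hy.2.le M
        calc ‖a‖ * ‖binomRem M (a - 1) y‖
            ≤ ‖a‖ * ((∏ l ∈ Finset.range M, ‖a - 1 - l‖) * 2 ^ (|a.re| + (M + 1 : ℕ)) * x ^ M) := by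
              refine mul_le_mul_of_nonneg_left (h1.trans ?_) (norm_nonneg _)
              have := hy.1
              gcongr
          _ = _ := by ring) x ⟨hx, le_rfl⟩
    rw [h0, sub_zero, sub_zero] at key
    refine key.trans_eq ?_
    ring

/-- The `n`-th remainder in the comparison of `∑ ((n + 2) ^ (1 - s) - (n + 1) ^ (1 - s))` with
zeta values at `s, s + 1, …`. -/
noncomputable def zetaRem (M : ℕ) (s : ℂ) (n : ℕ) : ℂ :=
  binomRem M (1 - s) (1 / ((n : ℝ) + 1)) * ((n : ℂ) + 1) ^ (1 - s)

lemma norm_zetaRem_le (M : ℕ) (s : ℂ) (n : ℕ) :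
    ‖zetaRem M s n‖ ≤ (‖s‖ + M + 1) ^ M * 2 ^ (|1 - s.re| + M) *
      ((n : ℝ) + 1) ^ (1 - s.re - M) := by
  have hn : (0 : ℝ) < (n : ℝ) + 1 := by positivity
  have h1 := norm_binomRem_le M (1 - s) (1 / ((n : ℝ) + 1)) (by positivity)
    (by rw [div_le_one hn]; linarith [(Nat.cast_nonneg n : (0 : ℝ) ≤ n)])
  have h2 : ∏ l ∈ Finset.range M, ‖1 - s - l‖ ≤ (‖s‖ + M + 1) ^ M := by
    calc _ ≤ ∏ _l ∈ Finset.range M, (‖s‖ + M + 1) := by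
          refine Finset.prod_le_prod (fun _ _ => norm_nonneg _) fun l hl => ?_
          refine (norm_sub_le _ _).trans ?_
          rw [Complex.norm_natCast]
          have h3 : ‖1 - s‖ ≤ 1 + ‖s‖ := (norm_sub_le _ _).trans (by simp)
          have h4 : (l : ℝ) ≤ M := by exact_mod_cast (Finset.mem_range.1 hl).le
          linarith
      _ = _ := by simp
  have h3 : ‖((n : ℂ) + 1) ^ (1 - s)‖ = ((n : ℝ) + 1) ^ (1 - s.re) := by
    have : ((n : ℂ) + 1) = (((n : ℝ) + 1 : ℝ) : ℂ) := by push_cast; rfl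
    rw [this, Complex.norm_cpow_eq_rpow_re_of_pos hn]
    simp
  rw [zetaRem, norm_mul, h3, Real.rpow_sub hn (1 - s.re), Real.rpow_natCast]
  have h4 : (1 - s).re = 1 - s.re := by simp
  rw [h4] at h1
  calc _ ≤ ((‖s‖ + M + 1) ^ M * 2 ^ (|1 - s.re| + M) * (1 / ((n : ℝ) + 1)) ^ M) *
        ((n : ℝ) + 1) ^ (1 - s.re) := by
        gcongr
        refine h1.trans ?_
        gcongr
    _ = _ := by
        rw [one_div, inv_pow]
        field_simp

lemma summable_nat_add_one_rpow {p : ℝ} (hp : p < -1) :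
    Summable fun n : ℕ => ((n : ℝ) + 1) ^ p := by
  have := (summable_nat_add_iff 1).2 (Real.summable_nat_rpow.2 hp)
  simpa using this

lemma summable_zetaRem (M : ℕ) {s : ℂ} (hs : 2 - M < s.re) : Summable (zetaRem M s) :=
  Summable.of_norm_bounded ((summable_nat_add_one_rpow (by linarith)).mul_left _)
    (norm_zetaRem_le M s)

lemma differentiable_zetaRem (M n : ℕ) : Differentiable ℂ fun s => zetaRem M s n := by
  have hn : (n : ℂ) + 1 ≠ 0 := Nat.cast_add_one_ne_zero n
  have h1 : (1 + ((1 / ((n : ℝ) + 1) : ℝ) : ℂ)) ≠ 0 := by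
    have h : (1 + ((1 / ((n : ℝ) + 1) : ℝ) : ℂ)) = ((1 + 1 / ((n : ℝ) + 1) : ℝ) : ℂ) := by
      push_cast; rfl
    rw [h, Complex.ofReal_ne_zero]
    positivity
  have h2 : Differentiable ℂ fun s : ℂ => (1 + ((1 / ((n : ℝ) + 1) : ℝ) : ℂ)) ^ (1 - s) :=
    fun s => (DifferentiableAt.const_cpow (by fun_prop) (Or.inl h1))
  have h3 : Differentiable ℂ fun s : ℂ => ((n : ℂ) + 1) ^ (1 - s) :=
    fun s => (DifferentiableAt.const_cpow (by fun_prop) (Or.inl hn))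
  have h4 : ∀ i, Differentiable ℂ fun s : ℂ => cbinom (1 - s) i := fun i =>
    (differentiable_cbinom i).comp (by fun_prop)
  unfold zetaRem binomRem
  fun_prop

lemma differentiableOn_tsum_zetaRem (M : ℕ) :
    DifferentiableOn ℂ (fun s => ∑' n, zetaRem M s n) {s | 2 - M < s.re} := by
  intro s hs
  have hs' : 2 - (M : ℝ) < s.re := hs
  obtain ⟨b, hb1, hb2⟩ := exists_between hs'
  set V : Set ℂ := {z | b < z.re} ∩ Metric.ball s 1 with hV
  have hVo : IsOpen V := (isOpen_lt continuous_const Complex.continuous_re).inter Metric.isOpen_ball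
  have hsV : s ∈ V := ⟨hb2, Metric.mem_ball_self one_pos⟩
  have hd : DifferentiableOn ℂ (fun s => ∑' n, zetaRem M s n) V := by
    refine Complex.differentiableOn_tsum_of_summable_norm
      (u := fun n : ℕ => (‖s‖ + 1 + M + 1) ^ M * 2 ^ ((‖s‖ + 2) + M) * ((n : ℝ) + 1) ^ (1 - b - M))
      ((summable_nat_add_one_rpow (by linarith)).mul_left _)
      (fun n => (differentiable_zetaRem M n).differentiableOn) hVo fun n z hz => ?_
    have h1 : ‖z‖ ≤ ‖s‖ + 1 := by
      have h := hz.2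
      rw [Metric.mem_ball, dist_eq_norm] at h
      have := norm_sub_norm_le z s
      linarith
    have h2 : |1 - z.re| ≤ ‖s‖ + 2 := by
      have := Complex.abs_re_le_norm z
      have := abs_sub (1 : ℝ) z.re
      rw [abs_one] at this
      linarith
    have h3 : b < z.re := hz.1
    refine (norm_zetaRem_le M z n).trans ?_
    have h4 : (1 : ℝ) ≤ (n : ℝ) + 1 := by linarith [(Nat.cast_nonneg n : (0 : ℝ) ≤ n)]
    gcongr
    exact one_le_two
  exact (hd.differentiableAt (hVo.mem_nhds hsV)).differentiableWithinAt

lemma hasSum_zeta_nat_add_one {s : ℂ} (hs : 1 < s.re) :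
    HasSum (fun n : ℕ => ((n : ℂ) + 1) ^ (-s)) (riemannZeta s) := by
  rw [zeta_eq_tsum_one_div_nat_add_one_cpow hs]
  have h : Summable fun n : ℕ => 1 / ((n : ℂ) + 1) ^ s := by
    have := (summable_nat_add_iff 1).2 (Complex.summable_one_div_nat_cpow.2 hs)
    simpa using this
  simpa [Complex.cpow_neg] using h.hasSum

/-- Expand `(n+2)^(1-s) - (n+1)^(1-s)` in powers of `1/(n+1)` and sum over `n`. The left side
telescopes to `-1`, and the expansion yields `(1-s) ζ(s)` together with zeta values further to the
right. -/
lemma riemannZeta₁_eq_of_one_lt_re (M : ℕ) {s : ℂ} (hs : 1 < s.re) :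
    riemannZeta₁ s = 1 - ∑ i ∈ Finset.range M,
      cbinom (1 - s) (i + 1) * riemannZeta₁ (s + i + 1) / ((i : ℂ) + 2) +
      ∑' n, zetaRem (M + 2) s n := by
  have hterm : ∀ n : ℕ, zetaRem (M + 2) s n =
      (((n + 1 : ℕ) : ℂ) + 1) ^ (1 - s) - ((n : ℂ) + 1) ^ (1 - s) -
      ((1 - s) * ((n : ℂ) + 1) ^ (-s) +
        ∑ i ∈ Finset.range M, cbinom (1 - s) (i + 2) * ((n : ℂ) + 1) ^ (-(s + i + 1))) := by
    intro n
    have hn : ((n : ℝ) + 1) ≠ 0 := by positivity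
    have hn' : (n : ℂ) + 1 ≠ 0 := Nat.cast_add_one_ne_zero n
    have hp : ∀ i : ℕ, (((1 / ((n : ℝ) + 1) : ℝ) : ℂ)) ^ i * ((n : ℂ) + 1) ^ (1 - s) =
        ((n : ℂ) + 1) ^ (1 - s - i) := by
      intro i
      rw [Complex.cpow_sub (1 - s) _ hn', Complex.cpow_natCast]
      push_cast
      field_simp
      rw [← mul_pow, one_div, inv_mul_cancel₀ hn', one_pow]
    have h1 : (1 + (((1 / ((n : ℝ) + 1) : ℝ)) : ℂ)) ^ (1 - s) * ((n : ℂ) + 1) ^ (1 - s) =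
        (((n + 1 : ℕ) : ℂ) + 1) ^ (1 - s) := by
      have e1 : (1 + (((1 / ((n : ℝ) + 1) : ℝ)) : ℂ)) = ((1 + 1 / ((n : ℝ) + 1) : ℝ) : ℂ) := by
        push_cast; rfl
      have e2 : (n : ℂ) + 1 = (((n : ℝ) + 1 : ℝ) : ℂ) := by push_cast; rfl
      rw [e1, e2, ← Complex.mul_cpow_ofReal_nonneg (by positivity) (by positivity)]
      congr 1
      push_cast
      field_simp
    rw [zetaRem, binomRem, sub_mul, h1, Finset.sum_mul, Finset.sum_range_succ',
      Finset.sum_range_succ']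
    simp only [mul_assoc, hp]
    simp only [cbinom_zero, zero_add, cbinom_one, Nat.cast_zero, sub_zero, one_mul, Nat.cast_one]
    have e3 : ∀ i : ℕ, 1 - s - ((i + 1 + 1 : ℕ) : ℂ) = -(s + i + 1) := by
      intro i; push_cast; ring
    have e4 : 1 - s - 1 = -s := by ring
    simp only [e3, e4]
    ring
  have hlim : Filter.Tendsto (fun N : ℕ => ∑ n ∈ Finset.range N, zetaRem (M + 2) s n)
      Filter.atTop (nhds (0 - 1 - ((1 - s) * riemannZeta s +
        ∑ i ∈ Finset.range M, cbinom (1 - s) (i + 2) * riemannZeta (s + i + 1)))) := by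
    have ht : ∀ N : ℕ, ∑ n ∈ Finset.range N, zetaRem (M + 2) s n =
        ((N : ℂ) + 1) ^ (1 - s) - 1 - ∑ n ∈ Finset.range N, ((1 - s) * ((n : ℂ) + 1) ^ (-s) +
        ∑ i ∈ Finset.range M, cbinom (1 - s) (i + 2) * ((n : ℂ) + 1) ^ (-(s + i + 1))) := by
      intro N
      rw [Finset.sum_congr rfl fun n _ => hterm n, Finset.sum_sub_distrib,
        Finset.sum_range_sub (fun n : ℕ => ((n : ℂ) + 1) ^ (1 - s))]
      simp
    simp only [ht]
    refine Filter.Tendsto.sub (Filter.Tendsto.sub_const ?_ _) ?_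
    · rw [tendsto_zero_iff_norm_tendsto_zero]
      have h1 : Filter.Tendsto (fun N : ℕ => ((N : ℝ) + 1) ^ (-(s.re - 1))) Filter.atTop (nhds 0) :=
        (tendsto_rpow_neg_atTop (by linarith)).comp
          (Filter.tendsto_atTop_add_const_right _ _ tendsto_natCast_atTop_atTop)
      refine h1.congr fun N => ?_
      have : ((N : ℂ) + 1) = (((N : ℝ) + 1 : ℝ) : ℂ) := by push_cast; rfl
      rw [this, Complex.norm_cpow_eq_rpow_re_of_pos (by positivity)]
      congr 1
      simp
    · refine HasSum.tendsto_sum_nat ?_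
      refine ((hasSum_zeta_nat_add_one hs).mul_left _).add (hasSum_sum fun i _ => ?_)
      refine (hasSum_zeta_nat_add_one ?_).mul_left _
      simp
      linarith [(Nat.cast_nonneg i : (0 : ℝ) ≤ i)]
  have hsum := (summable_zetaRem (M + 2) (s := s) (by push_cast; linarith [(Nat.cast_nonneg M : (0 : ℝ) ≤ M)])).hasSum.tendsto_sum_nat
  rw [tendsto_nhds_unique hsum hlim]
  have hs1 : s - 1 ≠ 0 := by
    intro h
    rw [sub_eq_zero.1 h] at hs
    simp at hs
  have hz : (1 - s) * riemannZeta s = - riemannZeta₁ s := by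
    rw [riemannZeta_eq_inv_sub_mul (sub_ne_zero.1 hs1)]
    field_simp
    ring
  have hzi : ∀ i ∈ Finset.range M, cbinom (1 - s) (i + 2) * riemannZeta (s + i + 1) =
      -(cbinom (1 - s) (i + 1) * riemannZeta₁ (s + i + 1) / ((i : ℂ) + 2)) := by
    intro i _
    have hsi : s + i ≠ 0 := by
      intro h
      have := congrArg Complex.re h
      simp at this
      linarith [(Nat.cast_nonneg i : (0 : ℝ) ≤ i)]
    have hi : (i : ℂ) + 2 ≠ 0 := by
      have := Nat.cast_add_one_ne_zero (R := ℂ) (i + 1)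
      push_cast at this
      rwa [add_assoc, one_add_one_eq_two] at this
    -- The factor `s + i` gained by the binomial coefficient cancels the pole of `ζ(s + i + 1)`, so
    -- the recursion involves only the entire function `riemannZeta₁`.
    have hc := cbinom_succ (1 - s) (i + 1)
    have e : (1 - s - ((i + 1 : ℕ) : ℂ)) = -(s + i) := by push_cast; ring
    rw [e] at hc
    rw [riemannZeta_eq_inv_sub_mul (s := s + i + 1) (by
      intro h; exact hsi (by linear_combination h))]
    have e2 : s + i + 1 - 1 = s + i := by ring
    rw [e2]
    field_simp
    push_cast at hc
    linear_combination riemannZeta₁ (s + i + 1) * hc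
  rw [hz, Finset.sum_congr rfl hzi, Finset.sum_neg_distrib]
  ring

/-- The remainder series converges locally uniformly for `Re s > -M`, so both sides are analytic
there and the identity theorem extends the recursion. -/
lemma riemannZeta₁_eq (M : ℕ) {s : ℂ} (hs : -M < s.re) :
    riemannZeta₁ s = 1 - ∑ i ∈ Finset.range M,
      cbinom (1 - s) (i + 1) * riemannZeta₁ (s + i + 1) / ((i : ℂ) + 2) +
      ∑' n, zetaRem (M + 2) s n := by
  have hset : {s : ℂ | 2 - ((M + 2 : ℕ) : ℝ) < s.re} = {s : ℂ | -(M : ℝ) < s.re} := by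
    ext z
    simp
  have hM : (0 : ℝ) ≤ M := Nat.cast_nonneg M
  have ho : IsOpen {s : ℂ | -(M : ℝ) < s.re} := isOpen_lt continuous_const Complex.continuous_re
  have hd := differentiableOn_tsum_zetaRem (M + 2)
  rw [hset] at hd
  have hZ : Differentiable ℂ riemannZeta₁ := differentiable_riemannZeta₁
  have hfin : Differentiable ℂ fun s : ℂ => 1 - ∑ i ∈ Finset.range M,
      cbinom (1 - s) (i + 1) * riemannZeta₁ (s + i + 1) / ((i : ℂ) + 2) := by
    have h4 : ∀ i, Differentiable ℂ fun s : ℂ => cbinom (1 - s) i := fun i =>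
      (differentiable_cbinom i).comp (by fun_prop)
    have h5 : ∀ i : ℕ, Differentiable ℂ fun s : ℂ => riemannZeta₁ (s + i + 1) := fun i =>
      hZ.comp (by fun_prop)
    fun_prop
  have key := AnalyticOnNhd.eqOn_of_preconnected_of_eventuallyEq
    (f := riemannZeta₁) (g := fun s : ℂ => 1 - ∑ i ∈ Finset.range M,
      cbinom (1 - s) (i + 1) * riemannZeta₁ (s + i + 1) / ((i : ℂ) + 2) +
      ∑' n, zetaRem (M + 2) s n) (U := {s : ℂ | -(M : ℝ) < s.re}) (z₀ := 2)
    (hZ.differentiableOn.analyticOnNhd ho)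
    ((hfin.differentiableOn.add hd).analyticOnNhd ho)
    (convex_halfSpace_re_gt _).isPreconnected
    (by simp; linarith)
    (by
      have : {s : ℂ | 1 < s.re} ∈ nhds (2 : ℂ) :=
        (isOpen_lt continuous_const Complex.continuous_re).mem_nhds (by simp)
      filter_upwards [this] with z hz using riemannZeta₁_eq_of_one_lt_re M hz)
  exact key hs

lemma norm_riemannZeta_le_of_two_le_re {s : ℂ} (hs : 2 ≤ s.re) :
    ‖riemannZeta s‖ ≤ ∑' n : ℕ, ((n : ℝ) + 1) ^ (-2 : ℝ) := by
  rw [← (hasSum_zeta_nat_add_one (by linarith)).tsum_eq]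
  refine tsum_of_norm_bounded (summable_nat_add_one_rpow (by norm_num)).hasSum fun n => ?_
  have hn : (1 : ℝ) ≤ (n : ℝ) + 1 := by linarith [(Nat.cast_nonneg n : (0 : ℝ) ≤ n)]
  have : ((n : ℂ) + 1) = (((n : ℝ) + 1 : ℝ) : ℂ) := by push_cast; rfl
  rw [this, Complex.norm_cpow_eq_rpow_re_of_pos (by linarith)]
  exact Real.rpow_le_rpow_of_exponent_le hn (by simpa using hs)

/-- `(s - 1) ζ(s)` grows at most polynomially on every right half-plane. -/
theorem exists_norm_riemannZeta₁_le_pow (N : ℕ) :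
    ∃ (C : ℝ) (A : ℕ), 0 ≤ C ∧
      ∀ s : ℂ, 2 - N ≤ s.re → ‖riemannZeta₁ s‖ ≤ C * (1 + ‖s‖) ^ A := by
  induction N with
  | zero =>
    refine ⟨∑' n : ℕ, ((n : ℝ) + 1) ^ (-2 : ℝ), 1, tsum_nonneg fun n => by positivity, ?_⟩
    intro s hs
    have hs2 : 2 ≤ s.re := by simpa using hs
    have hs1 : s ≠ 1 := by
      rintro rfl
      norm_num at hs2
    have hs0 : s - 1 ≠ 0 := sub_ne_zero.2 hs1
    have : riemannZeta₁ s = riemannZeta s * (s - 1) := by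
      rw [riemannZeta_eq_inv_sub_mul hs1]
      field_simp
    rw [this, norm_mul, pow_one]
    refine mul_le_mul (norm_riemannZeta_le_of_two_le_re hs2) ?_ (norm_nonneg _)
      (tsum_nonneg fun n => by positivity)
    refine (norm_sub_le _ _).trans ?_
    rw [norm_one, add_comm]
  | succ N ih =>
    obtain ⟨C, A, hC, hA⟩ := ih
    set S : ℝ := ∑' n : ℕ, ((n : ℝ) + 1) ^ (-2 : ℝ) with hS
    have hS0 : 0 ≤ S := tsum_nonneg fun n => by positivity
    -- a common polynomial majorant
    set K : ℝ := N + 3 with hK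
    have hK1 : 1 ≤ K := by rw [hK]; linarith [(Nat.cast_nonneg N : (0 : ℝ) ≤ N)]
    refine ⟨1 + N * (K ^ (N + 1) * (C * K ^ A)) + K ^ (N + 2) * 2 ^ (2 * (N : ℝ) + 3) * S + C,
      N + A + 2, by positivity, ?_⟩
    intro s hs
    set X : ℝ := 1 + ‖s‖ with hX
    have hX1 : 1 ≤ X := by linarith [norm_nonneg s]
    by_cases h : 2 - N ≤ s.re
    · calc ‖riemannZeta₁ s‖ ≤ C * X ^ A := hA s h
        _ ≤ C * X ^ (N + A + 2) := by
            refine mul_le_mul_of_nonneg_left (pow_le_pow_right₀ hX1 (by omega)) ?_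
            positivity
        _ ≤ _ := by
            gcongr
            have : 0 ≤ 1 + N * (K ^ (N + 1) * (C * K ^ A)) + K ^ (N + 2) * 2 ^ (2 * (N : ℝ) + 3) * S := by positivity
            linarith
    -- In the new strip `1 - N ≤ Re s < 2 - N`, the recursion with `M = N` calls only on arguments
    -- of real part at least `2 - N`, covered by induction. The remainder terms are there bounded by
    -- a multiple of `(n+1)^(-2)`.
    · push Not at h
      push_cast at hs
      have hN0 : (0 : ℝ) ≤ N := Nat.cast_nonneg N
      have hi : ∀ i ∈ Finset.range N,
          ‖cbinom (1 - s) (i + 1) * riemannZeta₁ (s + i + 1) / ((i : ℂ) + 2)‖ ≤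
            K ^ (N + 1) * (C * K ^ A) * X ^ (N + A + 2) := by
        intro i hi
        have hiN : (i : ℝ) + 1 ≤ N := by exact_mod_cast Finset.mem_range.1 hi
        have hi0 : (0 : ℝ) ≤ i := Nat.cast_nonneg i
        have h1 : ‖cbinom (1 - s) (i + 1)‖ ≤ (K * X) ^ (N + 1) := by
          refine (norm_cbinom_le _ _).trans ?_
          have h3 : ‖1 - s‖ ≤ X := (norm_sub_le _ _).trans (by simp [hX])
          have h4 : ‖1 - s‖ + ((i + 1 : ℕ) : ℝ) ≤ K * X := by
            push_cast
            nlinarith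
          calc _ ≤ (K * X) ^ (i + 1) := by gcongr
            _ ≤ (K * X) ^ (N + 1) := by
              refine pow_le_pow_right₀ (one_le_mul_of_one_le_of_one_le hK1 hX1) ?_
              have := Finset.mem_range.1 hi
              omega
        have h2 : ‖riemannZeta₁ (s + i + 1)‖ ≤ C * (K * X) ^ A := by
          refine (hA _ (by simp; linarith)).trans ?_
          gcongr
          have : ‖s + i + 1‖ ≤ ‖s‖ + i + 1 := by
            refine (norm_add_le _ _).trans ?_
            rw [norm_one]
            gcongr
            refine (norm_add_le _ _).trans ?_
            simp
          nlinarith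
        have h5 : 1 ≤ ‖(i : ℂ) + 2‖ := by
          have : (i : ℂ) + 2 = ((i + 2 : ℕ) : ℂ) := by push_cast; rfl
          rw [this, Complex.norm_natCast]
          push_cast
          linarith
        rw [norm_div, norm_mul]
        refine (div_le_self (by positivity) h5).trans ?_
        calc _ ≤ (K * X) ^ (N + 1) * (C * (K * X) ^ A) := by gcongr
          _ = K ^ (N + 1) * (C * K ^ A) * X ^ (N + A + 1) := by
              rw [mul_pow, mul_pow]; ring
          _ ≤ _ := by
              refine mul_le_mul_of_nonneg_left (pow_le_pow_right₀ hX1 (by omega)) ?_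
              positivity
      have hT : ‖∑' n, zetaRem (N + 2) s n‖ ≤
          K ^ (N + 2) * 2 ^ (2 * (N : ℝ) + 3) * S * X ^ (N + A + 2) := by
        have hb : ∀ n, ‖zetaRem (N + 2) s n‖ ≤
            ((K * X) ^ (N + 2) * 2 ^ (2 * (N : ℝ) + 3)) * ((n : ℝ) + 1) ^ (-2 : ℝ) := by
          intro n
          refine (norm_zetaRem_le _ _ _).trans ?_
          have hn : (1 : ℝ) ≤ (n : ℝ) + 1 := by linarith [(Nat.cast_nonneg n : (0 : ℝ) ≤ n)]
          have h6 : |1 - s.re| ≤ N + 1 := by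
            rw [abs_le]
            constructor <;> linarith
          have h7 : ‖s‖ + ((N + 2 : ℕ) : ℝ) + 1 ≤ K * X := by
            push_cast
            nlinarith [norm_nonneg s]
          have h8 : (2 : ℝ) ^ (|1 - s.re| + ((N + 2 : ℕ) : ℝ)) ≤ 2 ^ (2 * (N : ℝ) + 3) :=
            Real.rpow_le_rpow_of_exponent_le one_le_two (by push_cast; linarith)
          have h9 : ((n : ℝ) + 1) ^ (1 - s.re - ((N + 2 : ℕ) : ℝ)) ≤ ((n : ℝ) + 1) ^ (-2 : ℝ) :=
            Real.rpow_le_rpow_of_exponent_le hn (by push_cast; linarith)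
          gcongr
        refine (tsum_of_norm_bounded
          ((summable_nat_add_one_rpow (by norm_num)).hasSum.mul_left _) hb).trans ?_
        rw [← hS, mul_pow]
        calc _ = K ^ (N + 2) * 2 ^ (2 * (N : ℝ) + 3) * S * X ^ (N + 2) := by ring
          _ ≤ _ := by
            refine mul_le_mul_of_nonneg_left (pow_le_pow_right₀ hX1 (by omega)) ?_
            positivity
      rw [riemannZeta₁_eq N (s := s) (by linarith)]
      have hX2 : 1 ≤ X ^ (N + A + 2) := one_le_pow₀ hX1
      calc _ ≤ 1 + N * (K ^ (N + 1) * (C * K ^ A) * X ^ (N + A + 2)) +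
            K ^ (N + 2) * 2 ^ (2 * (N : ℝ) + 3) * S * X ^ (N + A + 2) := by
            refine (norm_add_le _ _).trans (add_le_add ((norm_sub_le _ _).trans ?_) hT)
            rw [norm_one]
            gcongr
            refine (norm_sum_le _ _).trans ((Finset.sum_le_sum hi).trans ?_)
            simp
        _ ≤ _ := by nlinarith [mul_nonneg hC (zero_le_one.trans hX2)]

/-! ### Shifting a vertical contour across one pole -/

open Complex in
/-- Moving a vertical line of integration by one unit across a pole of order at most two. -/
theorem integral_vertical_sub_integral_vertical {U f : ℂ → ℂ} {p C : ℝ}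
    (hU : DifferentiableOn ℂ U {w | |w.re - p| < 1})
    (hf : ∀ w : ℂ, w ≠ p → |w.re - p| < 1 → f w = U w / (w - p) ^ 2)
    (h₁ : MeasureTheory.Integrable fun t : ℝ => f ((p + 1 / 2 : ℝ) + t * I))
    (h₂ : MeasureTheory.Integrable fun t : ℝ => f ((p - 1 / 2 : ℝ) + t * I))
    (hC : ∀ w : ℂ, |w.re - p| < 1 → 1 ≤ |w.im| → ‖f w‖ ≤ C / |w.im|) :
    (∫ t : ℝ, f ((p + 1 / 2 : ℝ) + t * I)) - ∫ t : ℝ, f ((p - 1 / 2 : ℝ) + t * I) =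
      2 * Real.pi * deriv U p := by
  set S : Set ℂ := {w | |w.re - p| < 1} with hS
  have hSo : IsOpen S := isOpen_lt (by fun_prop) continuous_const
  have hpS : (p : ℂ) ∈ S := by simp [hS]
  have hSn : S ∈ nhds (p : ℂ) := hSo.mem_nhds hpS
  -- Dividing twice by `w - p` removes the principal part: `H = f - A/(w-p)² - B/(w-p)` extends
  -- holomorphically across `p`, so Cauchy's theorem on rectangles applies to `H`.
  set H : ℂ → ℂ := dslope (dslope U p) p with hH
  set A : ℂ := U p
  set B : ℂ := deriv U p
  have hHd : DifferentiableOn ℂ H S :=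
    (Complex.differentiableOn_dslope hSn).2 ((Complex.differentiableOn_dslope hSn).2 hU)
  have hHe : ∀ w : ℂ, w ≠ p → |w.re - p| < 1 →
      H w = f w - A / (w - p) ^ 2 - B / (w - p) := by
    intro w hw hwS
    have hw' : w - p ≠ 0 := sub_ne_zero.2 hw
    rw [hH, dslope_of_ne _ hw, slope_def_field, dslope_of_ne _ hw, slope_def_field, dslope_same,
      hf w hw hwS]
    field_simp
    ring
  -- the two vertical lines
  have hl : ∀ (e : ℝ), e ^ 2 = 1 / 4 → ∀ t : ℝ, H ((p + e : ℝ) + t * I) =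
      f ((p + e : ℝ) + t * I) - A / (e + t * I) ^ 2 - B / (e + t * I) := by
    intro e he t
    have he0 : e ≠ 0 := by rintro rfl; norm_num at he
    have hne : ((p + e : ℝ) + t * I : ℂ) ≠ p := by
      intro h
      have := congrArg Complex.re h
      simp at this
      exact he0 this
    have hlt : |((p + e : ℝ) + t * I : ℂ).re - p| < 1 := by
      have : ((p + e : ℝ) + t * I : ℂ).re - p = e := by simp
      rw [this, abs_lt]
      constructor <;> nlinarith
    rw [hHe _ hne hlt]
    have : ((p + e : ℝ) + t * I : ℂ) - p = e + t * I := by push_cast; ring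
    rw [this]
  have hne : ∀ (e : ℝ), e ^ 2 = 1 / 4 → ∀ t : ℝ, (e : ℂ) + t * I ≠ 0 := by
    intro e he t h
    have := congrArg Complex.re h
    simp at this
    rw [this] at he
    norm_num at he
  have hc2 : ∀ (e : ℝ), e ^ 2 = 1 / 4 → Continuous fun t : ℝ => A / ((e : ℂ) + t * I) ^ 2 :=
    fun e he => continuous_const.div (by fun_prop) fun t => pow_ne_zero 2 (hne e he t)
  have hc1 : ∀ (e : ℝ), e ^ 2 = 1 / 4 → Continuous fun t : ℝ => B / ((e : ℂ) + t * I) :=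
    fun e he => continuous_const.div (by fun_prop) fun t => hne e he t
  have hq : ((1 / 2 : ℝ)) ^ 2 = 1 / 4 := by norm_num
  have hq' : ((-(1 / 2) : ℝ)) ^ 2 = 1 / 4 := by norm_num
  -- The simple-pole terms on the two lines differ by `4B/(1 + 4t²)`, with primitive `2B
  -- arctan(2t)`; the limit `T → ∞` gives `2πB`.
  have hatan : ∀ T : ℝ, (∫ t in (-T)..T, (B / (((1 / 2 : ℝ) : ℂ) + t * I) -
      B / (((-(1 / 2) : ℝ) : ℂ) + t * I))) = (4 * Real.arctan (2 * T) : ℝ) * B := by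
    intro T
    have hd : ∀ t : ℝ, HasDerivAt (fun t : ℝ => ((2 * Real.arctan (2 * t) : ℝ) : ℂ) * B)
        (B / (((1 / 2 : ℝ) : ℂ) + t * I) - B / (((-(1 / 2) : ℝ) : ℂ) + t * I)) t := by
      intro t
      have h1 : HasDerivAt (fun t : ℝ => 2 * Real.arctan (2 * t))
          (2 * (1 / (1 + (2 * t) ^ 2) * (2 * 1))) t :=
        (((hasDerivAt_id t).const_mul 2).arctan).const_mul 2
      refine (h1.ofReal_comp.mul_const B).congr_deriv ?_
      have h2 := hne _ hq t
      have h3 := hne _ hq' t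
      have h4 : (1 + (2 * (t : ℂ)) ^ 2) ≠ 0 := by
        have : (1 + (2 * (t : ℂ)) ^ 2) = ((1 + (2 * t) ^ 2 : ℝ) : ℂ) := by push_cast; rfl
        rw [this, Complex.ofReal_ne_zero]
        positivity
      rw [div_sub_div _ _ h2 h3, eq_div_iff (mul_ne_zero h2 h3)]
      push_cast at h2 h3 ⊢
      have h5 : (1 / 2 + (t : ℂ) * I) * (-(1 / 2) + t * I) = -(1 + (2 * (t : ℂ)) ^ 2) / 4 := by
        linear_combination (t : ℂ) ^ 2 * I_sq
      rw [h5]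
      generalize (1 + (2 * (t : ℂ)) ^ 2) = D at h4 ⊢
      field_simp
      ring
    rw [intervalIntegral.integral_eq_sub_of_hasDerivAt (fun t _ => hd t)
      (((hc1 _ hq).sub (hc1 _ hq')).intervalIntegrable _ _)]
    rw [mul_neg, Real.arctan_neg]
    push_cast
    ring
  -- The double-pole terms cancel between the two lines under `t ↦ -t`.
  have hsq : ∀ T : ℝ, (∫ t in (-T)..T, A / (((-(1 / 2) : ℝ) : ℂ) + t * I) ^ 2) =
      ∫ t in (-T)..T, A / (((1 / 2 : ℝ) : ℂ) + t * I) ^ 2 := by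
    intro T
    have := intervalIntegral.integral_comp_neg (a := -T) (b := T)
      (fun t : ℝ => A / (((1 / 2 : ℝ) : ℂ) + t * I) ^ 2)
    rw [neg_neg] at this
    rw [← this]
    refine intervalIntegral.integral_congr fun t _ => ?_
    congr 1
    push_cast
    ring
  have hHc : ∀ (e : ℝ), e ^ 2 = 1 / 4 → Continuous fun t : ℝ => H ((p + e : ℝ) + t * I) := by
    intro e he
    refine hHd.continuousOn.comp_continuous (by fun_prop) fun t => ?_
    have : ((p + e : ℝ) + t * I : ℂ).re - p = e := by simp
    rw [hS, Set.mem_ofPred_eq, this, abs_lt]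
    constructor <;> nlinarith
  have e2 : p - 1 / 2 = p + -(1 / 2) := by ring
  rw [e2] at h₂ ⊢
  have hfi : ∀ (e : ℝ), MeasureTheory.Integrable (fun t : ℝ => f ((p + e : ℝ) + t * I)) →
      ∀ T : ℝ, IntervalIntegrable (fun t : ℝ => f ((p + e : ℝ) + t * I)) MeasureTheory.volume
        (-T) T := fun e h T => h.intervalIntegrable
  have hdiff : ∀ T : ℝ, (∫ t in (-T)..T, H ((p + 1 / 2 : ℝ) + t * I)) -
      (∫ t in (-T)..T, H ((p + -(1 / 2) : ℝ) + t * I)) =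
      (∫ t in (-T)..T, f ((p + 1 / 2 : ℝ) + t * I)) -
      (∫ t in (-T)..T, f ((p + -(1 / 2) : ℝ) + t * I)) - (4 * Real.arctan (2 * T) : ℝ) * B := by
    intro T
    have hi : ∀ (e : ℝ), e ^ 2 = 1 / 4 →
        MeasureTheory.Integrable (fun t : ℝ => f ((p + e : ℝ) + t * I)) →
        (∫ t in (-T)..T, H ((p + e : ℝ) + t * I)) =
        (∫ t in (-T)..T, f ((p + e : ℝ) + t * I)) - (∫ t in (-T)..T, A / ((e : ℂ) + t * I) ^ 2) -
        ∫ t in (-T)..T, B / ((e : ℂ) + t * I) := by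
      intro e he h
      rw [← intervalIntegral.integral_sub (hfi e h T) ((hc2 e he).intervalIntegrable _ _),
        ← intervalIntegral.integral_sub ((hfi e h T).sub ((hc2 e he).intervalIntegrable _ _))
          ((hc1 e he).intervalIntegrable _ _)]
      exact intervalIntegral.integral_congr fun t _ => hl e he t
    rw [hi _ hq h₁, hi _ hq' h₂, hsq T, ← hatan T, intervalIntegral.integral_sub
      ((hc1 _ hq).intervalIntegrable _ _) ((hc1 _ hq').intervalIntegrable _ _)]
    ring
  -- the left side tends to zero
  have hzero : Filter.Tendsto (fun T : ℝ => (∫ t in (-T)..T, H ((p + 1 / 2 : ℝ) + t * I)) -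
      (∫ t in (-T)..T, H ((p + -(1 / 2) : ℝ) + t * I))) Filter.atTop (nhds 0) := by
    set K : ℝ := |C| + ‖A‖ + ‖B‖
    have hb : ∀ T : ℝ, 1 ≤ T → ∀ x : ℝ, |x - p| < 1 → ∀ y : ℝ, |y| = T →
        ‖H (x + y * I)‖ ≤ K / T := by
      intro T hT x hx y hy
      have hT0 : 0 < T := by linarith
      have hre : (x + y * I : ℂ).re = x := by simp
      have him : (x + y * I : ℂ).im = y := by simp
      have hle : T ≤ ‖(x + y * I : ℂ) - p‖ := by
        have := Complex.abs_im_le_norm ((x + y * I : ℂ) - p)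
        simpa [hy] using this
      have hn0 : (x + y * I : ℂ) ≠ p := by
        intro h
        rw [h, sub_self, norm_zero] at hle
        linarith
      rw [hHe _ hn0 (by rwa [hre])]
      have b1 : ‖f (x + y * I)‖ ≤ |C| / T := by
        have := hC (x + y * I) (by rwa [hre]) (by rwa [him, hy])
        rw [him, hy] at this
        refine this.trans ?_
        gcongr
        exact le_abs_self C
      have b2 : ‖A / ((x + y * I : ℂ) - p) ^ 2‖ ≤ ‖A‖ / T := by
        rw [norm_div, norm_pow]
        gcongr
        calc T ≤ T ^ 2 := by nlinarith
          _ ≤ _ := by gcongr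
      have b3 : ‖B / ((x + y * I : ℂ) - p)‖ ≤ ‖B‖ / T := by
        rw [norm_div]
        gcongr
      calc _ ≤ |C| / T + ‖A‖ / T + ‖B‖ / T :=
            (norm_sub_le _ _).trans (add_le_add ((norm_sub_le _ _).trans (add_le_add b1 b2)) b3)
        _ = K / T := by ring
    have hrect : ∀ T : ℝ, 1 ≤ T → ‖(∫ t in (-T)..T, H ((p + 1 / 2 : ℝ) + t * I)) -
        (∫ t in (-T)..T, H ((p + -(1 / 2) : ℝ) + t * I))‖ ≤ 2 * K / T := by
      intro T hT
      have hr := Complex.integral_boundary_rect_eq_zero_of_differentiableOn H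
        ((p + -(1 / 2) : ℝ) + (-T : ℝ) * I) ((p + 1 / 2 : ℝ) + (T : ℝ) * I) (hHd.mono (by
          intro w hw
          have h1 := hw.1
          have : (((p + -(1 / 2) : ℝ) : ℂ) + (-T : ℝ) * I).re = p + -(1 / 2) := by simp
          have h3 : (((p + 1 / 2 : ℝ) : ℂ) + (T : ℝ) * I).re = p + 1 / 2 := by simp
          rw [Set.mem_preimage, this, h3, Set.uIcc_of_le (by linarith)] at h1
          rw [hS, Set.mem_ofPred_eq, abs_lt]
          constructor <;> linarith [h1.1, h1.2]))
      simp only [add_re, add_im, mul_re, mul_im, ofReal_re, ofReal_im, I_re, I_im, mul_zero,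
        mul_one, add_zero, sub_zero, zero_add, smul_eq_mul] at hr
      have hh : ∀ y : ℝ, |y| = T →
          ‖∫ x in (p + -(1 / 2))..(p + 1 / 2), H (x + y * I)‖ ≤ K / T := by
        intro y hy
        have := intervalIntegral.norm_integral_le_of_norm_le_const (a := p + -(1 / 2))
          (b := p + 1 / 2) (f := fun x : ℝ => H (x + y * I)) (C := K / T) (fun x hx => by
            rw [Set.uIoc_of_le (by linarith)] at hx
            refine hb T hT x ?_ y hy
            rw [abs_lt]
            constructor <;> linarith [hx.1, hx.2])
        refine this.trans_eq ?_
        have : p + 1 / 2 - (p + -(1 / 2)) = 1 := by ring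
        rw [this]
        simp
      have g1 := hh (-T) (by rw [abs_neg, abs_of_pos (by linarith)])
      have g2 := hh T (abs_of_pos (by linarith))
      have : (∫ t in (-T)..T, H ((p + 1 / 2 : ℝ) + t * I)) -
          (∫ t in (-T)..T, H ((p + -(1 / 2) : ℝ) + t * I)) =
          I * ((∫ x in (p + -(1 / 2))..(p + 1 / 2), H (x + (-T : ℝ) * I)) -
            ∫ x in (p + -(1 / 2))..(p + 1 / 2), H (x + (T : ℝ) * I)) := by
        linear_combination (-I) * hr + ((∫ t in (-T)..T, H ((p + 1 / 2 : ℝ) + t * I)) -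
          (∫ t in (-T)..T, H ((p + -(1 / 2) : ℝ) + t * I))) * I_sq
      rw [this, norm_mul, norm_I, one_mul]
      calc _ ≤ K / T + K / T := (norm_sub_le _ _).trans (add_le_add g1 g2)
        _ = _ := by ring
    refine squeeze_zero_norm' ?_ (Filter.Tendsto.div_atTop (a := 2 * K) tendsto_const_nhds
      Filter.tendsto_id)
    filter_upwards [Filter.eventually_ge_atTop 1] with T hT using hrect T hT
  have hlim : Filter.Tendsto (fun T : ℝ => (∫ t in (-T)..T, f ((p + 1 / 2 : ℝ) + t * I)) -
      (∫ t in (-T)..T, f ((p + -(1 / 2) : ℝ) + t * I)) - (4 * Real.arctan (2 * T) : ℝ) * B)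
      Filter.atTop (nhds ((∫ t : ℝ, f ((p + 1 / 2 : ℝ) + t * I)) -
        (∫ t : ℝ, f ((p + -(1 / 2) : ℝ) + t * I)) - (4 * (Real.pi / 2) : ℝ) * B)) := by
    have ha : Filter.Tendsto (fun T : ℝ => Real.arctan (2 * T)) Filter.atTop
        (nhds (Real.pi / 2)) :=
      (Real.tendsto_arctan_atTop.mono_right nhdsWithin_le_nhds).comp
        (Filter.Tendsto.const_mul_atTop two_pos Filter.tendsto_id)
    refine Filter.Tendsto.sub (Filter.Tendsto.sub ?_ ?_) ?_
    · exact MeasureTheory.intervalIntegral_tendsto_integral h₁ Filter.tendsto_neg_atTop_atBot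
        Filter.tendsto_id
    · exact MeasureTheory.intervalIntegral_tendsto_integral h₂ Filter.tendsto_neg_atTop_atBot
        Filter.tendsto_id
    · exact ((Complex.continuous_ofReal.tendsto _).comp (ha.const_mul 4)).mul_const B
  have := tendsto_nhds_unique hlim (hzero.congr fun T => hdiff T)
  push_cast at this ⊢
  linear_combination this

/-! ### Mellin transforms of the exponential and of `K₀` -/

open Complex MeasureTheory Set in
lemma integrableOn_rpow_mul_exp_neg_mul {s b : ℝ} (hs : 0 < s) (hb : 0 < b) :
    IntegrableOn (fun x : ℝ => x ^ (s - 1) * Real.exp (-b * x)) (Ioi 0) := by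
  simpa using integrableOn_rpow_mul_exp_neg_mul_rpow (p := 1) (s := s - 1) (by linarith) one_pos hb

open Complex MeasureTheory Set in
lemma norm_cpow_mul_exp_neg_mul {a s : ℂ} {y : ℝ} (hy : 0 < y) :
    ‖(y : ℂ) ^ (s - 1) • cexp (-a * y)‖ = y ^ (s.re - 1) * Real.exp (-a.re * y) := by
  rw [norm_smul, norm_cpow_eq_rpow_re_of_pos hy, Complex.norm_exp]
  simp

open Complex MeasureTheory Set in
lemma aestronglyMeasurable_cpow_smul {g : ℝ → ℂ} (hg : Continuous g) (s : ℂ) :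
    AEStronglyMeasurable (fun y : ℝ => (y : ℂ) ^ (s - 1) • g y) (volume.restrict (Ioi 0)) := by
  refine ContinuousOn.aestronglyMeasurable ?_ measurableSet_Ioi
  simp only [smul_eq_mul]
  refine ContinuousOn.mul (fun y hy => ?_) hg.continuousOn
  exact (continuousAt_ofReal_cpow_const _ _ (Or.inr (ne_of_gt hy))).continuousWithinAt

open Complex MeasureTheory Set in
lemma mellinConvergent_exp_neg_mul {a s : ℂ} (ha : 0 < a.re) (hs : 0 < s.re) :
    MellinConvergent (fun y : ℝ => cexp (-a * y)) s := by
  refine (integrableOn_rpow_mul_exp_neg_mul hs ha).mono' ?_ ?_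
  · exact aestronglyMeasurable_cpow_smul (by fun_prop) s
  · filter_upwards [ae_restrict_mem measurableSet_Ioi] with y hy
    exact (norm_cpow_mul_exp_neg_mul hy).le

open Complex MeasureTheory Set in
lemma differentiableOn_mellin_exp_neg_mul {s : ℂ} (hs : 0 < s.re) :
    DifferentiableOn ℂ (fun a : ℂ => mellin (fun y : ℝ => cexp (-a * y)) s) {a | 0 < a.re} := by
  intro a ha
  have ha' : 0 < a.re := ha
  set F' : ℂ → ℝ → ℂ := fun a y => (y : ℂ) ^ (s - 1) • (cexp (-a * y) * (-y))
  have hmeas : ∀ b : ℂ, AEStronglyMeasurable (fun y : ℝ => (y : ℂ) ^ (s - 1) • cexp (-b * y))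
      (volume.restrict (Ioi 0)) := fun b =>
    aestronglyMeasurable_cpow_smul (by fun_prop) s
  have h := hasDerivAt_integral_of_dominated_loc_of_deriv_le
    (F := fun (a : ℂ) (y : ℝ) => (y : ℂ) ^ (s - 1) • cexp (-a * y)) (F' := F') (x₀ := a)
    (s := {z : ℂ | a.re / 2 < z.re}) (μ := volume.restrict (Ioi 0))
    (bound := fun y => y ^ ((s.re + 1) - 1) * Real.exp (-(a.re / 2) * y))
    ((isOpen_lt continuous_const continuous_re).mem_nhds (by simpa using ha'))
    (Filter.Eventually.of_forall hmeas)
    (mellinConvergent_exp_neg_mul ha' hs)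
    (aestronglyMeasurable_cpow_smul (by fun_prop) s)
    (by
      filter_upwards [ae_restrict_mem measurableSet_Ioi] with y hy z hz
      have hy' : 0 < y := hy
      have hz' : a.re / 2 < z.re := hz
      have : F' z y = ((y : ℂ) ^ (s - 1) • cexp (-z * y)) * (-y) := by
        simp only [F', smul_eq_mul]; ring
      rw [this, norm_mul, norm_cpow_mul_exp_neg_mul hy', norm_neg, norm_real, Real.norm_eq_abs,
        abs_of_pos hy', add_sub_cancel_right]
      have e : y ^ s.re = y ^ (s.re - 1) * y := by
        rw [← Real.rpow_add_one hy'.ne']; ring_nf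
      rw [e]
      calc _ = y ^ (s.re - 1) * y * Real.exp (-z.re * y) := by ring
        _ ≤ _ := by gcongr)
    (integrableOn_rpow_mul_exp_neg_mul (by linarith) (by linarith))
    (by
      refine Filter.Eventually.of_forall fun y z _ => ?_
      have : HasDerivAt (fun a : ℂ => -a * (y : ℂ)) (-1 * (y : ℂ)) z :=
        ((hasDerivAt_id z).neg).mul_const _
      refine ((this.cexp).const_mul ((y : ℂ) ^ (s - 1))).congr_deriv ?_
      simp [F'])
  exact h.2.differentiableAt.differentiableWithinAt

open Complex MeasureTheory Set in
/-- `∫₀^∞ y^(s-1) e^(-ay) dy = a^(-s) Γ(s)` for complex `a` with positive real part. -/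
theorem mellin_exp_neg_mul {a s : ℂ} (ha : 0 < a.re) (hs : 0 < s.re) :
    mellin (fun y : ℝ => cexp (-a * y)) s = a ^ (-s) * Complex.Gamma s := by
  have ho : IsOpen {a : ℂ | 0 < a.re} := isOpen_lt continuous_const continuous_re
  have hreal : ∀ r : ℝ, 0 < r →
      mellin (fun y : ℝ => cexp (-(r : ℂ) * y)) s = (r : ℂ) ^ (-s) * Complex.Gamma s := by
    intro r hr
    have h := integral_cpow_mul_exp_neg_mul_Ioi hs hr
    rw [mellin]
    simp only [smul_eq_mul, neg_mul]
    rw [h, one_div, inv_cpow _ _ (by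
      rw [arg_ofReal_of_nonneg hr.le]; exact Real.pi_pos.ne), cpow_neg]
  have hg : DifferentiableOn ℂ (fun a : ℂ => a ^ (-s) * Complex.Gamma s) {a | 0 < a.re} := by
    intro z hz
    refine (DifferentiableAt.mul_const ?_ _).differentiableWithinAt
    exact differentiableAt_id.cpow_const (Or.inl hz)
  -- The formula is known for real `a > 0`. Both sides are holomorphic in `a`, and the real points
  -- `1 + 1/(n+1)` accumulate at `1`, so it holds in the whole half-plane.
  refine AnalyticOnNhd.eqOn_of_preconnected_of_frequently_eq (𝕜 := ℂ) (z₀ := 1)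
    ((differentiableOn_mellin_exp_neg_mul hs).analyticOnNhd ho) (hg.analyticOnNhd ho)
    (convex_halfSpace_re_gt 0).isPreconnected (by simp) ?_ ha
  have ht : Filter.Tendsto (fun n : ℕ => ((1 + 1 / ((n : ℝ) + 1) : ℝ) : ℂ)) Filter.atTop
      (nhdsWithin 1 {1}ᶜ) := by
    refine tendsto_nhdsWithin_iff.2 ⟨?_, Filter.Eventually.of_forall fun n => ?_⟩
    · have : Filter.Tendsto (fun n : ℕ => (1 + 1 / ((n : ℝ) + 1) : ℝ)) Filter.atTop (nhds (1 + 0)) :=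
        tendsto_one_div_add_atTop_nhds_zero_nat.const_add 1
      rw [add_zero] at this
      exact_mod_cast (Complex.continuous_ofReal.tendsto 1).comp this
    · rw [mem_compl_singleton_iff]
      intro h
      have h' : (1 + 1 / ((n : ℝ) + 1) : ℝ) = 1 := by exact_mod_cast h
      have : (0 : ℝ) < 1 / ((n : ℝ) + 1) := by positivity
      linarith
  exact ht.frequently (Filter.Frequently.of_forall fun n => hreal _ (by positivity))

open Complex MeasureTheory Set in
/-- `∫₀^∞ cosh(t)^(-2w) dt` in terms of Gamma functions. -/
theorem integral_cosh_cpow {w : ℂ} (hw : 0 < w.re) (hi : IntegrableOn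
    (fun t : ℝ => ((Real.cosh t : ℝ) : ℂ) ^ (-(2 * w))) (Ioi 0)) :
    Complex.Gamma (2 * w) * ∫ t in Ioi (0 : ℝ), ((Real.cosh t : ℝ) : ℂ) ^ (-(2 * w)) =
      2 ^ (2 * w - 2) * Complex.Gamma w ^ 2 := by
  -- `φ(t) = 1/(1 + e^(-2t))` maps `ℝ` bijectively onto `(0,1)`, with `φ' = 2φ(1-φ)` and `φ(1-φ) =
  -- 1/(4 cosh² t)`. It turns the Beta integral `B(w,w)` into an integral of `cosh^(-2w)` over the
  -- line.
  set φ : ℝ → ℝ := fun t => Real.exp t / (2 * Real.cosh t) with hφ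
  have hc : ∀ t, 0 < Real.cosh t := Real.cosh_pos
  have hφ1 : ∀ t, 1 - φ t = Real.exp (-t) / (2 * Real.cosh t) := fun t => by
    have := Real.cosh_eq t
    have := (hc t).ne'
    simp only [hφ]
    field_simp
    linarith
  have hφφ : ∀ t, φ t * (1 - φ t) = 1 / (4 * Real.cosh t ^ 2) := fun t => by
    rw [hφ1]
    have := (hc t).ne'
    have h := Real.exp_add t (-t)
    rw [add_neg_cancel, Real.exp_zero] at h
    simp only [hφ]
    field_simp
    linear_combination (-4) * h
  have hφ0 : ∀ t, 0 < φ t := fun t => div_pos (Real.exp_pos t) (by linarith [hc t])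
  have hφ0' : ∀ t, 0 < 1 - φ t := fun t => by
    rw [hφ1]; exact div_pos (Real.exp_pos _) (by linarith [hc t])
  have hder : ∀ t, HasDerivAt φ (2 * (φ t * (1 - φ t))) t := fun t => by
    have h := (Real.hasDerivAt_exp t).div ((Real.hasDerivAt_cosh t).const_mul 2)
      (by have := hc t; positivity)
    refine h.congr_deriv ?_
    rw [hφφ]
    have h1 := (hc t).ne'
    have h2 := Real.cosh_sub_sinh t
    have h3 := Real.exp_add t (-t)
    rw [add_neg_cancel, Real.exp_zero] at h3
    field_simp
    linear_combination (4 * Real.exp t) * h2 - 4 * h3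
  have hinj : InjOn φ univ := by
    refine (strictMono_of_hasDerivAt_pos hder fun t => ?_).injective.injOn
    have := hφ0 t
    have := hφ0' t
    positivity
  have himg : φ '' univ = Ioo 0 1 := by
    ext x
    constructor
    · rintro ⟨t, -, rfl⟩
      exact ⟨hφ0 t, by linarith [hφ0' t]⟩
    · rintro ⟨h0, h1⟩
      refine ⟨Real.log (x / (1 - x)) / 2, mem_univ _, ?_⟩
      have h1' : 0 < 1 - x := by linarith
      set t := Real.log (x / (1 - x)) / 2 with ht
      have he : Real.exp t * Real.exp t = x / (1 - x) := by
        rw [← Real.exp_add, ht, add_halves, Real.exp_log (div_pos h0 h1')]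
      have h3 := Real.exp_add t (-t)
      rw [add_neg_cancel, Real.exp_zero] at h3
      have h4 := hφ1 t
      have hcc := (hc t).ne'
      simp only [hφ]
      rw [div_eq_iff (by positivity), Real.cosh_eq]
      rw [eq_div_iff h1'.ne'] at he
      have h5 : Real.exp t * (Real.exp t * (1 - x) - x * Real.exp (-t)) = 0 := by
        linear_combination he + x * h3
      rcases mul_eq_zero.1 h5 with h | h
      · exact absurd h (Real.exp_pos t).ne'
      · linarith
  have hbeta : betaIntegral w w = 2 ^ (1 - 2 * w) * ∫ t : ℝ, ((Real.cosh t : ℝ) : ℂ) ^ (-(2 * w)) := by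
    rw [betaIntegral, intervalIntegral.integral_of_le zero_le_one, integral_Ioc_eq_integral_Ioo,
      ← himg, integral_image_eq_integral_abs_deriv_smul MeasurableSet.univ
        (fun t _ => (hder t).hasDerivWithinAt) hinj, Measure.restrict_univ, ← integral_const_mul]
    refine integral_congr_ae (Filter.Eventually.of_forall fun t => ?_)
    have hp : 0 < φ t * (1 - φ t) := mul_pos (hφ0 t) (hφ0' t)
    simp only
    rw [abs_of_pos (by positivity), real_smul]
    have e1 : (φ t : ℂ) ^ (w - 1) * (1 - (φ t : ℂ)) ^ (w - 1) =
        ((φ t * (1 - φ t) : ℝ) : ℂ) ^ (w - 1) := by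
      have := mul_cpow_ofReal_nonneg (hφ0 t).le (hφ0' t).le (w - 1)
      push_cast at this ⊢
      rw [this]
    have e2 : ((φ t * (1 - φ t) : ℝ) : ℂ) ≠ 0 := ofReal_ne_zero.2 hp.ne'
    have e3 : ((2 * (φ t * (1 - φ t)) : ℝ) : ℂ) * ((φ t * (1 - φ t) : ℝ) : ℂ) ^ (w - 1) =
        2 * ((φ t * (1 - φ t) : ℝ) : ℂ) ^ w := by
      rw [cpow_sub _ _ e2, cpow_one, ofReal_mul 2, ofReal_ofNat]
      field_simp
    rw [e1, e3, hφφ]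
    have e4 : (1 / (4 * Real.cosh t ^ 2) : ℝ) = ((2 * Real.cosh t) ^ (2 : ℕ))⁻¹ := by
      rw [one_div]; congr 1; ring
    have e5 : (0 : ℝ) < 2 * Real.cosh t := by linarith [hc t]
    have e6 : (((2 * Real.cosh t) ^ (2 : ℕ))⁻¹ : ℝ) = (2 * Real.cosh t) ^ (-2 : ℝ) := by
      rw [Real.rpow_neg e5.le]; norm_cast
    have e7 : ((-2 : ℝ) : ℂ) * w = -(2 * w) := by push_cast; ring
    rw [e4, e6, ← cpow_mul_ofReal_nonneg e5.le, ofReal_mul 2, e7,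
      mul_cpow_ofReal_nonneg zero_le_two (hc t).le, ← mul_assoc]
    congr 1
    rw [sub_eq_add_neg, cpow_add _ _ two_ne_zero, cpow_one, ofReal_ofNat]
  have hfull : ∫ t : ℝ, ((Real.cosh t : ℝ) : ℂ) ^ (-(2 * w)) =
      2 * ∫ t in Ioi (0 : ℝ), ((Real.cosh t : ℝ) : ℂ) ^ (-(2 * w)) := by
    have hneg := integral_comp_neg_Iic (0 : ℝ) (fun t : ℝ => ((Real.cosh t : ℝ) : ℂ) ^ (-(2 * w)))
    have hineg : IntegrableOn (fun t : ℝ => ((Real.cosh t : ℝ) : ℂ) ^ (-(2 * w))) (Iic 0) := by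
      refine (integrableOn_Iic_iff_integrableOn_Iio).2 ?_
      have := ((Measure.measurePreserving_neg (volume : Measure ℝ)).integrableOn_comp_preimage
        (Homeomorph.neg ℝ).measurableEmbedding).2 hi
      simpa [Function.comp_def] using this
    simp only [Real.cosh_neg, neg_zero] at hneg
    rw [← intervalIntegral.integral_Iic_add_Ioi hineg hi, hneg]
    ring
  have hG := Gamma_mul_Gamma_eq_betaIntegral hw hw
  rw [hbeta, hfull, ← two_mul] at hG
  have h2 : (2 : ℂ) ^ (2 * w - 2) * 2 ^ (1 - 2 * w) * 2 = 1 := by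
    rw [← cpow_add _ _ two_ne_zero]
    have : 2 * w - 2 + (1 - 2 * w) = -1 := by ring
    rw [this, cpow_neg_one]
    norm_num
  rw [pow_two, hG]
  linear_combination (-(Complex.Gamma (2 * w) * ∫ t in Ioi (0 : ℝ), ((Real.cosh t : ℝ) : ℂ) ^ (-(2 * w)))) * h2

open Complex MeasureTheory Set in
lemma besselK_zero (z : ℂ) :
    besselK 0 z = ∫ t in Ioi (0 : ℝ), cexp (-z * (Real.cosh t : ℝ)) := by
  simp [besselK]

open Complex MeasureTheory Set in
lemma integrableOn_cosh_rpow {p : ℝ} (hp : 0 < p) :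
    IntegrableOn (fun t : ℝ => Real.cosh t ^ (-p)) (Ioi 0) := by
  refine ((exp_neg_integrableOn_Ioi 0 hp).const_mul ((2 : ℝ) ^ p)).mono' ?_ ?_
  · refine (Continuous.rpow_const Real.continuous_cosh fun t => ?_).aestronglyMeasurable
    exact Or.inl (Real.cosh_pos t).ne'
  · refine Filter.Eventually.of_forall fun t => ?_
    have h1 : Real.exp t / 2 ≤ Real.cosh t := by
      rw [Real.cosh_eq]
      linarith [Real.exp_pos (-t)]
    rw [Real.norm_of_nonneg (Real.rpow_nonneg (Real.cosh_pos t).le _)]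
    calc Real.cosh t ^ (-p) ≤ (Real.exp t / 2) ^ (-p) :=
          Real.rpow_le_rpow_of_nonpos (by positivity) h1 (by linarith)
      _ = 2 ^ p * Real.exp (-p * t) := by
          rw [Real.div_rpow (Real.exp_pos t).le zero_le_two, ← Real.exp_mul, Real.rpow_neg zero_le_two]
          field_simp

open Complex MeasureTheory Set in
lemma integrableOn_cosh_cpow {w : ℂ} (hw : 0 < w.re) :
    IntegrableOn (fun t : ℝ => ((Real.cosh t : ℝ) : ℂ) ^ (-(2 * w))) (Ioi 0) := by
  refine (integrableOn_cosh_rpow (p := 2 * w.re) (by linarith)).mono' ?_ ?_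
  · refine Continuous.aestronglyMeasurable ?_
    refine Continuous.cpow (by fun_prop) continuous_const fun t => ?_
    exact ofReal_mem_slitPlane.2 (Real.cosh_pos t)
  · refine Filter.Eventually.of_forall fun t => ?_
    rw [norm_cpow_eq_rpow_re_of_pos (Real.cosh_pos t)]
    simp

/-- The integrand of the Mellin transform of `X ↦ K₀(b √X)`. -/
noncomputable def besselKernel (b w : ℂ) (X t : ℝ) : ℂ :=
  (X : ℂ) ^ (w - 1) • Complex.exp (-(b * (Real.sqrt X : ℝ)) * (Real.cosh t : ℝ))

open Complex MeasureTheory Set in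
lemma norm_besselKernel {b w : ℂ} {X : ℝ} (hX : 0 < X) (t : ℝ) :
    ‖besselKernel b w X t‖ =
      X ^ (w.re - 1) * Real.exp (-(b.re * Real.cosh t) * X ^ (1 / 2 : ℝ)) := by
  rw [besselKernel, norm_smul, norm_cpow_eq_rpow_re_of_pos hX, Complex.norm_exp, Real.sqrt_eq_rpow]
  congr 2
  simp [-ofReal_cosh]
  ring

open Complex MeasureTheory Set in
-- With `y = √X` and a rescaling by `cosh t`, this is the Gamma integral with complex parameter `b`;
-- the square root doubles `w`.
lemma integral_besselKernel_left {b w : ℂ} (hb : 0 < b.re) (hw : 0 < w.re) (t : ℝ) :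
    IntegrableOn (fun X => besselKernel b w X t) (Ioi 0) ∧
    ∫ X in Ioi (0 : ℝ), besselKernel b w X t =
      2 * (b ^ (-(2 * w)) * Complex.Gamma (2 * w)) * ((Real.cosh t : ℝ) : ℂ) ^ (-(2 * w)) := by
  have hc := Real.cosh_pos t
  set G : ℝ → ℂ := fun y => cexp (-b * y)
  have hF : (fun X : ℝ => cexp (-(b * (Real.sqrt X : ℝ)) * (Real.cosh t : ℝ))) =
      fun X : ℝ => (fun y => G (Real.cosh t * y)) (X ^ (1 / 2 : ℝ)) := by
    funext X
    simp only [G, Real.sqrt_eq_rpow]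
    congr 1
    push_cast
    ring
  have h2 : w / ((1 / 2 : ℝ) : ℂ) = 2 * w := by push_cast; field_simp
  have hw2 : 0 < (2 * w).re := by simpa using hw
  constructor
  · have : MellinConvergent (fun X : ℝ => cexp (-(b * (Real.sqrt X : ℝ)) * (Real.cosh t : ℝ))) w := by
      rw [hF]
      refine (MellinConvergent.comp_rpow (f := fun y => G (Real.cosh t * y)) (a := 1 / 2)
        (by norm_num)).2 ?_
      rw [h2]
      exact (MellinConvergent.comp_mul_left (f := G) hc).2 (mellinConvergent_exp_neg_mul hb hw2)
    exact this
  · have : mellin (fun X : ℝ => cexp (-(b * (Real.sqrt X : ℝ)) * (Real.cosh t : ℝ))) w =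
        2 * (b ^ (-(2 * w)) * Complex.Gamma (2 * w)) * ((Real.cosh t : ℝ) : ℂ) ^ (-(2 * w)) := by
      rw [hF]
      refine (mellin_comp_rpow (fun y => G (Real.cosh t * y)) w (1 / 2)).trans ?_
      rw [h2, mellin_comp_mul_left G _ hc, mellin_exp_neg_mul hb hw2,
        abs_of_pos (by norm_num : (0 : ℝ) < 1 / 2), real_smul, smul_eq_mul]
      push_cast
      ring
    exact this

open Complex MeasureTheory Set in
-- Justifies Fubini: integrating the norm in `X` leaves a constant times `cosh(t)^(-2 Re w)`, which
-- is integrable in `t`.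
lemma integrable_besselKernel {b w : ℂ} (hb : 0 < b.re) (hw : 0 < w.re) :
    Integrable (Function.uncurry (besselKernel b w))
      ((volume.restrict (Ioi (0 : ℝ))).prod (volume.restrict (Ioi (0 : ℝ)))) := by
  have hm : AEStronglyMeasurable (Function.uncurry (besselKernel b w))
      ((volume.restrict (Ioi (0 : ℝ))).prod (volume.restrict (Ioi (0 : ℝ)))) := by
    refine Measurable.aestronglyMeasurable ?_
    unfold besselKernel Function.uncurry
    simp only [smul_eq_mul]
    refine Measurable.mul ?_ ?_
    · exact (Complex.measurable_ofReal.comp measurable_fst).pow_const _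
    · refine Continuous.measurable ?_
      fun_prop
  refine (integrable_prod_iff' hm).2 ⟨?_, ?_⟩
  · exact Filter.Eventually.of_forall fun t => (integral_besselKernel_left hb hw t).1
  · have : (fun t : ℝ => ∫ X in Ioi (0 : ℝ), ‖Function.uncurry (besselKernel b w) (X, t)‖) =
        fun t => (b.re ^ (-(w.re - 1 + 1) / (1 / 2)) * (1 / (1 / 2)) *
          Real.Gamma ((w.re - 1 + 1) / (1 / 2))) * Real.cosh t ^ (-(2 * w.re)) := by
      funext t
      have hc := Real.cosh_pos t
      have h1 : ∫ X in Ioi (0 : ℝ), ‖Function.uncurry (besselKernel b w) (X, t)‖ =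
          ∫ X in Ioi (0 : ℝ), X ^ (w.re - 1) *
            Real.exp (-(b.re * Real.cosh t) * X ^ (1 / 2 : ℝ)) :=
        setIntegral_congr_fun measurableSet_Ioi fun X hX => norm_besselKernel hX t
      rw [h1, _root_.integral_rpow_mul_exp_neg_mul_rpow (by norm_num) (by linarith) (mul_pos hb hc),
        Real.mul_rpow hb.le hc.le]
      have h2 : -(w.re - 1 + 1) / (1 / 2) = -(2 * w.re) := by ring
      rw [h2]
      ring
    rw [this]
    exact (integrableOn_cosh_rpow (by linarith)).const_mul _

open Complex MeasureTheory Set in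
-- Interchange the integrals over `X` and `t`. The factor `Γ(2w)` from the inner one combines with
-- the integral of `cosh^(-2w)` by `integral_cosh_cpow`, leaving `Γ(w)²`.
lemma mellin_besselK {b w : ℂ} (hb : 0 < b.re) (hw : 0 < w.re) :
    MellinConvergent (fun X : ℝ => besselK 0 (b * (Real.sqrt X : ℝ))) w ∧
    mellin (fun X : ℝ => besselK 0 (b * (Real.sqrt X : ℝ))) w =
      2 ^ (2 * w - 1) * b ^ (-(2 * w)) * Complex.Gamma w ^ 2 := by
  have hI := integrable_besselKernel hb hw
  have hF : ∀ X : ℝ, (X : ℂ) ^ (w - 1) • besselK 0 (b * (Real.sqrt X : ℝ)) =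
      ∫ t in Ioi (0 : ℝ), besselKernel b w X t := by
    intro X
    rw [besselK_zero, ← integral_smul]
    rfl
  constructor
  · rw [MellinConvergent]
    simp only [hF]
    exact hI.integral_prod_left
  · rw [mellin]
    simp only [hF]
    rw [integral_integral_swap hI]
    simp only [(integral_besselKernel_left hb hw _).2]
    rw [integral_const_mul]
    have h := integral_cosh_cpow hw (integrableOn_cosh_cpow hw)
    have h2 : (2 : ℂ) ^ (2 * w - 1) = 2 * 2 ^ (2 * w - 2) := by
      have : 2 * w - 1 = 2 * w - 2 + 1 := by ring
      rw [this, cpow_add _ _ two_ne_zero, cpow_one, mul_comm]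
    rw [h2]
    linear_combination (2 * b ^ (-(2 * w))) * h

open Complex MeasureTheory Set in
lemma continuousAt_besselK {b : ℂ} (hb : 0 < b.re) {X : ℝ} (hX : 0 < X) :
    ContinuousAt (fun X : ℝ => besselK 0 (b * (Real.sqrt X : ℝ))) X := by
  simp only [besselK_zero]
  have hs : 0 < Real.sqrt (X / 2) := Real.sqrt_pos.2 (by linarith)
  refine continuousAt_of_dominated (bound := fun t => Real.exp (-(b.re * Real.sqrt (X / 2)) * t))
    (Filter.Eventually.of_forall fun Y => Continuous.aestronglyMeasurable (by fun_prop)) ?_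
    (exp_neg_integrableOn_Ioi 0 (mul_pos hb hs))
    (Filter.Eventually.of_forall fun t => by fun_prop)
  filter_upwards [lt_mem_nhds (show X / 2 < X by linarith)] with Y hY
  filter_upwards [ae_restrict_mem measurableSet_Ioi] with t ht
  have ht' : 0 < t := ht
  rw [Complex.norm_exp]
  have : (-(b * (Real.sqrt Y : ℝ)) * (Real.cosh t : ℝ)).re = -(b.re * Real.sqrt Y * Real.cosh t) := by
    simp [-ofReal_cosh]
  rw [this, neg_mul]
  have h1 : Real.sqrt (X / 2) ≤ Real.sqrt Y := Real.sqrt_le_sqrt hY.le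
  have h2 : t ≤ Real.cosh t := (Real.self_le_sinh_iff.2 ht'.le).trans (Real.sinh_lt_cosh t).le
  gcongr

/-! ### The Koshliakov kernel and its Mellin transform -/

open Complex in
-- The arguments `±π/4` lie inside the principal range, so the logarithm splits without a branch
-- correction. The two phases later add up to a cosine.
lemma cpow_koshliakovEps (w : ℂ) :
    (4 * (Real.pi : ℂ) * koshliakovEps) ^ w =
      (4 * (Real.pi : ℂ)) ^ w * cexp (I * Real.pi / 4 * w) ∧
    (4 * (Real.pi : ℂ) * (starRingEnd ℂ) koshliakovEps) ^ w =
      (4 * (Real.pi : ℂ)) ^ w * cexp (-(I * Real.pi / 4 * w)) := by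
  have hp : (0 : ℝ) < 4 * Real.pi := by positivity
  have key : ∀ θ : ℝ, |θ| < Real.pi → (4 * (Real.pi : ℂ) * cexp (θ * I)) ^ w =
      (4 * (Real.pi : ℂ)) ^ w * cexp (θ * I * w) := by
    intro θ hθ
    rw [abs_lt] at hθ
    have h4 : (4 * (Real.pi : ℂ)) = ((4 * Real.pi : ℝ) : ℂ) := by push_cast; rfl
    have hne : (4 * (Real.pi : ℂ)) ≠ 0 := by rw [h4]; exact ofReal_ne_zero.2 hp.ne'
    rw [cpow_def_of_ne_zero (mul_ne_zero hne (exp_ne_zero _)), cpow_def_of_ne_zero hne,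
      ← Complex.exp_add, h4, log_ofReal_mul hp (exp_ne_zero _), log_exp (by simpa using hθ.1) (by simpa using hθ.2.le), ofReal_log hp.le]
    congr 1
    ring
  have hpi := Real.pi_pos
  have e1 : koshliakovEps = cexp (((Real.pi / 4 : ℝ) : ℂ) * I) := by
    rw [koshliakovEps]; congr 1; push_cast; ring
  have e2 : (starRingEnd ℂ) koshliakovEps = cexp (((-(Real.pi / 4) : ℝ) : ℂ) * I) := by
    rw [e1, ← exp_conj]
    rw [map_mul, conj_ofReal, conj_I]
    push_cast
    congr 1
    ring
  constructor
  · rw [e1, key _ (by rw [abs_lt]; constructor <;> linarith)]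
    congr 2
    push_cast
    ring
  · rw [e2, key _ (by rw [abs_lt]; constructor <;> linarith)]
    congr 2
    push_cast
    ring

/-- `X ↦ K₀(4πε√X) + K₀(4πε̄√X)`. -/
noncomputable def koshliakovKernel (X : ℝ) : ℂ :=
  besselK 0 (4 * (Real.pi : ℂ) * koshliakovEps * (Real.sqrt X : ℝ)) +
    besselK 0 (4 * (Real.pi : ℂ) * (starRingEnd ℂ) koshliakovEps * (Real.sqrt X : ℝ))

lemma koshliakovEps_re_pos : 0 < koshliakovEps.re := by
  have : koshliakovEps = Complex.exp (((Real.pi / 4 : ℝ) : ℂ) * Complex.I) := by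
    rw [koshliakovEps]; congr 1; push_cast; ring
  rw [this, Complex.exp_ofReal_mul_I_re, Real.cos_pi_div_four]
  positivity

lemma four_pi_mul_koshliakovEps_re_pos :
    0 < (4 * (Real.pi : ℂ) * koshliakovEps).re ∧
    0 < (4 * (Real.pi : ℂ) * (starRingEnd ℂ) koshliakovEps).re := by
  have h := koshliakovEps_re_pos
  have hp := Real.pi_pos
  have e : (4 * (Real.pi : ℂ)) = ((4 * Real.pi : ℝ) : ℂ) := by push_cast; rfl
  rw [e, Complex.re_ofReal_mul, Complex.re_ofReal_mul, Complex.conj_re]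
  exact ⟨by positivity, by positivity⟩

lemma continuousAt_koshliakovKernel {X : ℝ} (hX : 0 < X) : ContinuousAt koshliakovKernel X :=
  (continuousAt_besselK four_pi_mul_koshliakovEps_re_pos.1 hX).add
    (continuousAt_besselK four_pi_mul_koshliakovEps_re_pos.2 hX)

open Complex in
/-- The Mellin transform of `X ↦ K₀(4πε√X) + K₀(4πε̄√X)`. -/
theorem mellin_koshliakovKernel {w : ℂ} (hw : 0 < w.re) :
    MellinConvergent koshliakovKernel w ∧
    mellin koshliakovKernel w =
      (2 * (Real.pi : ℂ)) ^ (-(2 * w)) * Complex.Gamma w ^ 2 * Complex.cos (Real.pi * w / 2) := by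
  obtain ⟨c1, m1⟩ := mellin_besselK four_pi_mul_koshliakovEps_re_pos.1 hw
  obtain ⟨c2, m2⟩ := mellin_besselK four_pi_mul_koshliakovEps_re_pos.2 hw
  have h := hasMellin_add c1 c2
  refine ⟨h.1, ?_⟩
  refine h.2.trans ?_
  rw [m1, m2, (cpow_koshliakovEps _).1, (cpow_koshliakovEps _).2]
  have e1 : I * (Real.pi : ℂ) / 4 * (-(2 * w)) = -(Real.pi * w / 2) * I := by ring
  have e2 : -(I * (Real.pi : ℂ) / 4 * (-(2 * w))) = (Real.pi * w / 2) * I := by ring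
  rw [e2, e1, Complex.cos]
  have e3 : (4 * (Real.pi : ℂ)) ^ (-(2 * w)) = 2 ^ (-(2 * w)) * (2 * (Real.pi : ℂ)) ^ (-(2 * w)) := by
    have := mul_cpow_ofReal_nonneg (a := 2) (b := 2 * Real.pi) zero_le_two (by positivity) (-(2 * w))
    push_cast at this
    rw [← this]
    congr 1
    ring
  have e4 : (2 : ℂ) ^ (2 * w - 1) * 2 ^ (-(2 * w)) * 2 = 1 := by
    rw [← cpow_add _ _ two_ne_zero]
    have : 2 * w - 1 + -(2 * w) = -1 := by ring
    rw [this, cpow_neg_one]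
    norm_num
  rw [e3]
  linear_combination ((2 * (Real.pi : ℂ)) ^ (-(2 * w)) * Complex.Gamma w ^ 2 *
    ((cexp (Real.pi * w / 2 * I) + cexp (-(Real.pi * w / 2) * I)) / 2)) * e4

/-! ### Decay of the spectral kernel on vertical lines -/

open Complex in
lemma exists_norm_riemannZeta_le (R : ℝ) : ∃ (C : ℝ) (A : ℕ), 0 ≤ C ∧
    ∀ s : ℂ, |s.re| ≤ R → 1 ≤ |s.im| → ‖riemannZeta s‖ ≤ C * |s.im| ^ A := by
  obtain ⟨N, hN⟩ := exists_nat_ge (R + 2)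
  obtain ⟨C, A, hC, hA⟩ := exists_norm_riemannZeta₁_le_pow N
  refine ⟨C * (2 + |R|) ^ A, A, by positivity, fun s hs hi => ?_⟩
  have hs1 : s - 1 ≠ 0 := by
    intro h
    rw [sub_eq_zero.1 h] at hi
    norm_num at hi
  have h1 : 1 ≤ ‖s - 1‖ := by
    refine hi.trans ?_
    simpa using Complex.abs_im_le_norm (s - 1)
  have h2 : ‖s‖ ≤ |R| + |s.im| := by
    refine (Complex.norm_le_abs_re_add_abs_im s).trans ?_
    linarith [hs.trans (le_abs_self R)]
  rw [riemannZeta_eq_inv_sub_mul (sub_ne_zero.1 hs1), norm_mul, norm_inv]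
  have hb := (abs_le.1 hs).1
  calc ‖s - 1‖⁻¹ * ‖riemannZeta₁ s‖ ≤ 1 * (C * (1 + ‖s‖) ^ A) := by
        gcongr
        · exact inv_le_one_of_one_le₀ h1
        · exact hA s (by linarith)
    _ ≤ C * ((2 + |R|) * |s.im|) ^ A := by
        rw [one_mul]
        gcongr
        nlinarith [abs_nonneg R]
    _ = _ := by rw [mul_pow]; ring

open Complex in
-- The cosine grows exponentially away from the real axis, `|2 cos z| ≥ e^|Im z| - e^(-|Im z|)`. An
-- arbitrary power of `|w.im|` is all that is needed to beat the growth of zeta.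
lemma pow_div_factorial_le_norm_cos (B : ℕ) {w : ℂ} (hw : 1 ≤ |w.im|) :
    |w.im| ^ B / (2 * B.factorial) ≤ ‖2 * cos (Real.pi * w / 2)‖ := by
  set z : ℂ := Real.pi * w / 2 with hz
  have hzi : z.im = Real.pi / 2 * w.im := by
    have : z = ((Real.pi / 2 : ℝ) : ℂ) * w := by rw [hz]; push_cast; ring
    rw [this, Complex.im_ofReal_mul]
  have hpi := Real.pi_gt_three
  have hle : |w.im| ≤ |z.im| := by
    rw [hzi, abs_mul, abs_of_pos (show 0 < Real.pi / 2 by linarith)]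
    nlinarith [abs_nonneg w.im]
  have hcos : Real.exp |z.im| - Real.exp (-|z.im|) ≤ ‖2 * cos z‖ := by
    have h1 : ‖exp (z * I)‖ = Real.exp (-z.im) := by rw [Complex.norm_exp]; simp
    have h2 : ‖exp (-z * I)‖ = Real.exp z.im := by rw [Complex.norm_exp]; simp
    rw [two_cos]
    rcases abs_cases z.im with ⟨h, _⟩ | ⟨h, _⟩
    · rw [h, ← h1, ← h2, add_comm (exp (z * I))]
      have := norm_sub_norm_le (exp (-z * I)) (-exp (z * I))
      rwa [norm_neg, sub_neg_eq_add] at this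
    · rw [h, neg_neg, ← h1, ← h2]
      have := norm_sub_norm_le (exp (z * I)) (-exp (-z * I))
      rwa [norm_neg, sub_neg_eq_add] at this
  have h3 : Real.exp (-|z.im|) ≤ Real.exp |z.im| / 2 := by
    have e : Real.exp |z.im| * Real.exp (-|z.im|) = 1 := by rw [← Real.exp_add]; simp
    have h5 : 2 ≤ Real.exp |z.im| := by
      have := Real.add_one_le_exp |z.im|
      linarith
    nlinarith [Real.exp_pos (-|z.im|)]
  have h4 := Real.pow_div_factorial_le_exp |w.im| (abs_nonneg _) B
  have h5 : Real.exp |w.im| ≤ Real.exp |z.im| := Real.exp_le_exp.2 hle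
  calc |w.im| ^ B / (2 * B.factorial) = |w.im| ^ B / B.factorial / 2 := by
        rw [div_div, mul_comm (2 : ℝ)]
    _ ≤ Real.exp |z.im| / 2 := by linarith
    _ ≤ _ := by linarith

open Complex in
lemma cos_pi_mul_div_two_ne_zero {w : ℂ} (hw : ∀ k : ℤ, w ≠ 2 * k + 1) :
    cos (Real.pi * w / 2) ≠ 0 := by
  intro h
  obtain ⟨k, hk⟩ := Complex.cos_eq_zero_iff.1 h
  refine hw k ?_
  have hp : (Real.pi : ℂ) ≠ 0 := ofReal_ne_zero.2 Real.pi_ne_zero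
  field_simp at hk
  exact hk

/-- The function whose inverse Mellin transform is the double series over `d(n) d(j)`. -/
noncomputable def spectralKernel (m : ℤ) (lam : ℝ) (w : ℂ) : ℂ :=
  riemannZeta (1 - w) ^ 2 * riemannZeta (w + 2 * m + 1) ^ 2 * (lam : ℂ) ^ (-w) /
    (2 * Complex.cos (Real.pi * w / 2))

open Complex in
lemma exists_norm_spectralKernel_le (m : ℤ) {lam : ℝ} (hl : 0 < lam) (R : ℝ) :
    ∃ C : ℝ, ∀ w : ℂ, |w.re| ≤ R → 1 ≤ |w.im| → ‖spectralKernel m lam w‖ ≤ C / |w.im| ^ 2 := by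
  obtain ⟨C₁, A₁, hC₁, h₁⟩ := exists_norm_riemannZeta_le (R + 1)
  obtain ⟨C₂, A₂, hC₂, h₂⟩ := exists_norm_riemannZeta_le (R + |2 * (m : ℝ) + 1|)
  -- The two squared zeta factors cost `2 A₁ + 2 A₂` powers of `|w.im|`; the extra `2` leaves
  -- inverse-square decay.
  set B : ℕ := 2 * A₁ + 2 * A₂ + 2
  refine ⟨C₁ ^ 2 * C₂ ^ 2 * Real.exp (R * |Real.log lam|) * (2 * B.factorial), fun w hw hi => ?_⟩
  have ht : 0 < |w.im| := by linarith
  have b1 : ‖riemannZeta (1 - w)‖ ≤ C₁ * |w.im| ^ A₁ := by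
    have := h₁ (1 - w) (by
      have := abs_sub 1 w.re
      rw [abs_one] at this
      simpa using this.trans (by linarith)) (by simpa using hi)
    simpa using this
  have b2 : ‖riemannZeta (w + 2 * m + 1)‖ ≤ C₂ * |w.im| ^ A₂ := by
    have e : w + 2 * m + 1 = w + ((2 * (m : ℝ) + 1 : ℝ) : ℂ) := by push_cast; ring
    have := h₂ (w + 2 * m + 1) (by
      rw [e, add_re, ofReal_re]
      exact (abs_add_le _ _).trans (by linarith)) (by rw [e]; simpa using hi)
    rw [e, add_im, ofReal_im, add_zero] at this
    rwa [e]
  have b3 : ‖(lam : ℂ) ^ (-w)‖ ≤ Real.exp (R * |Real.log lam|) := by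
    rw [norm_cpow_eq_rpow_re_of_pos hl, Real.rpow_def_of_pos hl]
    refine Real.exp_le_exp.2 ?_
    calc Real.log lam * (-w).re ≤ |Real.log lam * (-w).re| := le_abs_self _
      _ = |Real.log lam| * |w.re| := by rw [abs_mul]; simp
      _ ≤ |Real.log lam| * R := by gcongr
      _ = _ := mul_comm _ _
  have b4 := pow_div_factorial_le_norm_cos B hi
  have hB : (0 : ℝ) < B.factorial := by exact_mod_cast B.factorial_pos
  rw [spectralKernel, norm_div, norm_mul, norm_mul, norm_pow, norm_pow]
  calc _ ≤ ((C₁ * |w.im| ^ A₁) ^ 2 * (C₂ * |w.im| ^ A₂) ^ 2 * Real.exp (R * |Real.log lam|)) /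
        (|w.im| ^ B / (2 * B.factorial)) := by gcongr
    _ = _ := by
        simp only [B]
        field_simp
        ring

open Complex in
lemma ne_intCast_of_re {σ : ℝ} (hσ : ∀ k : ℤ, σ ≠ k) (t : ℝ) (k : ℤ) : (σ : ℂ) + t * I ≠ k := by
  intro h
  have := congrArg Complex.re h
  simp at this
  exact hσ k this

open Complex in
lemma differentiableAt_spectralKernel (m : ℤ) {lam : ℝ} (hl : 0 < lam) {w : ℂ}
    (h0 : w ≠ 0) (h1 : w ≠ -(2 * m)) (h2 : ∀ k : ℤ, w ≠ 2 * k + 1) :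
    DifferentiableAt ℂ (spectralKernel m lam) w := by
  have d1 : DifferentiableAt ℂ (fun w : ℂ => riemannZeta (1 - w)) w :=
    (differentiableAt_riemannZeta (s := 1 - w) (by
      intro h; exact h0 (by linear_combination -h))).comp w (by fun_prop)
  have d2 : DifferentiableAt ℂ (fun w : ℂ => riemannZeta (w + 2 * m + 1)) w :=
    (differentiableAt_riemannZeta (s := w + 2 * m + 1) (by
      intro h; exact h1 (by linear_combination h))).comp w (by fun_prop)
  have d3 : DifferentiableAt ℂ (fun w : ℂ => (lam : ℂ) ^ (-w)) w :=
    DifferentiableAt.const_cpow (by fun_prop) (Or.inl (ofReal_ne_zero.2 hl.ne'))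
  unfold spectralKernel
  exact (((d1.pow 2).mul (d2.pow 2)).mul d3).div (by fun_prop)
    (mul_ne_zero two_ne_zero (cos_pi_mul_div_two_ne_zero h2))

open Complex in
lemma differentiableAt_spectralKernel_line (m : ℤ) {lam : ℝ} (hl : 0 < lam) {σ : ℝ}
    (hσ : ∀ k : ℤ, σ ≠ k) (t : ℝ) : DifferentiableAt ℂ (spectralKernel m lam) (σ + t * I) := by
  have h := ne_intCast_of_re hσ t
  refine differentiableAt_spectralKernel m hl ?_ ?_ fun k => ?_
  · exact_mod_cast h 0
  · have := h (-(2 * m))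
    push_cast at this
    exact this
  · have := h (2 * k + 1)
    push_cast at this
    exact this

open MeasureTheory in
lemma integrable_of_norm_le_div_sq {g : ℝ → ℂ} (hg : Continuous g) {C : ℝ}
    (hC : ∀ t : ℝ, 1 ≤ |t| → ‖g t‖ ≤ C / |t| ^ 2) : Integrable g := by
  obtain ⟨M, hM⟩ := isCompact_Icc.exists_bound_of_continuousOn (s := Set.Icc (-1 : ℝ) 1)
    hg.continuousOn
  refine (integrable_inv_one_add_sq.const_mul (2 * (|C| + |M|))).mono' hg.aestronglyMeasurable
    (Filter.Eventually.of_forall fun t => ?_)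
  rw [← div_eq_mul_inv, le_div_iff₀ (by positivity)]
  rcases le_total 1 |t| with h | h
  · have h1 := hC t h
    have h2 : 1 ≤ |t| ^ 2 := one_le_pow₀ h
    rw [sq_abs] at h1 h2
    rw [le_div_iff₀ (by linarith)] at h1
    nlinarith [norm_nonneg (g t), le_abs_self C, abs_nonneg M]
  · have h1 := hM t (abs_le.1 h)
    have h2 : t ^ 2 ≤ 1 := by rw [← sq_abs]; exact pow_le_one₀ (abs_nonneg t) h
    nlinarith [norm_nonneg (g t), le_abs_self M, abs_nonneg C]

open Complex in
lemma integrable_spectralKernel (m : ℤ) {lam : ℝ} (hl : 0 < lam) {σ : ℝ} (hσ : ∀ k : ℤ, σ ≠ k) :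
    MeasureTheory.Integrable fun t : ℝ => spectralKernel m lam (σ + t * I) := by
  obtain ⟨C, hC⟩ := exists_norm_spectralKernel_le m hl |σ|
  refine integrable_of_norm_le_div_sq (C := C) ?_ fun t ht => ?_
  · refine continuous_iff_continuousAt.2 fun t => ?_
    exact (differentiableAt_spectralKernel_line m hl hσ t).continuousAt.comp
      (f := fun t : ℝ => (σ : ℂ) + t * I) (by fun_prop)
  · have := hC (σ + t * I) (by simp) (by simpa using ht)
    simpa using this

/-! ### Mellin inversion and the contour integral for the double series -/

/-- Here `|ζ(s) - 1| ≤ ζ(2) - 1`. The resulting lower bound is positive and uniform, which permits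
division by zeta on vertical lines. -/
lemma two_sub_le_norm_riemannZeta {s : ℂ} (hs : 2 ≤ s.re) :
    2 - Real.pi ^ 2 / 6 ≤ ‖riemannZeta s‖ := by
  have h1 := hasSum_zeta_nat_add_one (s := s) (by linarith)
  have h2 : HasSum (fun n : ℕ => (((n + 1 : ℕ) : ℂ) + 1) ^ (-s)) (riemannZeta s - 1) := by
    have := (hasSum_nat_add_iff' 1).2 h1
    simpa using this
  have h3 : HasSum (fun n : ℕ => 1 / ((n + 2 : ℕ) : ℝ) ^ 2) (Real.pi ^ 2 / 6 - 1) := by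
    have := (hasSum_nat_add_iff' 2).2 hasSum_zeta_two
    simpa [Finset.sum_range_succ] using this
  have h4 : ‖riemannZeta s - 1‖ ≤ Real.pi ^ 2 / 6 - 1 := by
    rw [← h2.tsum_eq]
    refine tsum_of_norm_bounded h3 fun n => ?_
    have e : (((n + 1 : ℕ) : ℂ) + 1) = ((n + 2 : ℕ) : ℝ) := by push_cast; ring
    rw [e, Complex.norm_cpow_eq_rpow_re_of_pos (by positivity), one_div, ← Real.rpow_natCast,
      ← Real.rpow_neg (by positivity)]
    refine Real.rpow_le_rpow_of_exponent_le ?_ (by simpa using hs)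
    push_cast
    linarith [(Nat.cast_nonneg n : (0 : ℝ) ≤ n)]
  have h5 : ‖(1 : ℂ)‖ - ‖riemannZeta s - 1‖ ≤ ‖riemannZeta s‖ := by
    have := norm_sub_norm_le (1 : ℂ) (1 - riemannZeta s)
    rw [norm_sub_rev 1 (riemannZeta s)] at this
    simpa using this
  rw [norm_one] at h5
  linarith

open Complex in
-- The square of the functional equation `ζ(1-w) = 2 (2π)^(-w) Γ(w) cos(πw/2) ζ(w)` absorbs both
-- Gamma factors and moves the cosine to the denominator.
lemma mellin_koshliakovKernel_mul_riemannZeta_sq {w : ℂ} (hw : 1 < w.re)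
    (h : cos (Real.pi * w / 2) ≠ 0) :
    2 * mellin koshliakovKernel w * riemannZeta w ^ 2 =
      riemannZeta (1 - w) ^ 2 / (2 * cos (Real.pi * w / 2)) := by
  rw [(mellin_koshliakovKernel (by linarith)).2, riemannZeta_one_sub (s := w)
    (fun n h => by
      rw [h] at hw
      simp at hw
      linarith [(Nat.cast_nonneg n : (0 : ℝ) ≤ n)])
    (fun h => by rw [h] at hw; simp at hw)]
  have e : (2 * (Real.pi : ℂ)) ^ (-(2 * w)) = ((2 * (Real.pi : ℂ)) ^ (-w)) ^ 2 := by
    rw [← cpow_nat_mul]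
    congr 1
    push_cast
    ring
  rw [e]
  field_simp

open Complex in
-- Stirling's formula is avoided: by the functional equation the transform equals `spectralKernel 0
-- 1`, already known to be integrable, divided by `2 ζ(w)² ζ(w+1)²`, which is bounded away from zero
-- on the line.
lemma verticalIntegrable_mellin_koshliakovKernel {c : ℝ} (hc : 2 ≤ c) (hcZ : ∀ k : ℤ, c ≠ k) :
    Complex.VerticalIntegrable (mellin koshliakovKernel) c := by
  have hlow : 0 < 2 - Real.pi ^ 2 / 6 := by
    nlinarith [Real.pi_lt_d2, Real.pi_pos]
  have hre : ∀ t : ℝ, ((c : ℂ) + t * I).re = c := fun t => by simp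
  have hre' : ∀ t : ℝ, ((c : ℂ) + t * I + 2 * ((0 : ℤ) : ℂ) + 1).re = c + 1 := fun t => by simp
  have hne : ∀ s : ℂ, 2 ≤ s.re → riemannZeta s ≠ 0 := fun s hs =>
    norm_pos_iff.1 (hlow.trans_le (two_sub_le_norm_riemannZeta hs))
  have hform : ∀ t : ℝ, mellin koshliakovKernel (c + t * I) =
      ((2 * riemannZeta (c + t * I) ^ 2 * riemannZeta (c + t * I + 2 * ((0 : ℤ) : ℂ) + 1) ^ 2)⁻¹) *
        spectralKernel 0 1 (c + t * I) := by
    intro t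
    have h1 := hne (c + t * I) (by rw [hre]; exact hc)
    have h2 := hne (c + t * I + 2 * ((0 : ℤ) : ℂ) + 1) (by rw [hre']; linarith)
    have h3 := mellin_koshliakovKernel_mul_riemannZeta_sq (w := c + t * I)
      (by rw [hre]; linarith) (cos_pi_mul_div_two_ne_zero fun k => by
        have := ne_intCast_of_re hcZ t (2 * k + 1)
        push_cast at this
        exact this)
    rw [spectralKernel, ofReal_one, one_cpow, mul_one, inv_mul_eq_div,
      eq_div_iff (mul_ne_zero (mul_ne_zero two_ne_zero (pow_ne_zero 2 h1)) (pow_ne_zero 2 h2))]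
    linear_combination (riemannZeta (c + t * I + 2 * ((0 : ℤ) : ℂ) + 1) ^ 2) * h3
  have hI := integrable_spectralKernel 0 one_pos hcZ
  unfold Complex.VerticalIntegrable
  simp only [hform]
  refine hI.bdd_mul (c := (2 * (2 - Real.pi ^ 2 / 6) ^ 2 * (2 - Real.pi ^ 2 / 6) ^ 2)⁻¹) ?_ ?_
  · refine Continuous.aestronglyMeasurable ?_
    have c1 : Continuous fun t : ℝ => riemannZeta (c + t * I) := continuous_iff_continuousAt.2 fun t =>
      (differentiableAt_riemannZeta (s := c + t * I) (by
        exact_mod_cast ne_intCast_of_re hcZ t 1)).continuousAt.comp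
        (f := fun t : ℝ => (c : ℂ) + t * I) (by fun_prop)
    have c2 : Continuous fun t : ℝ => riemannZeta (c + t * I + 2 * ((0 : ℤ) : ℂ) + 1) :=
      continuous_iff_continuousAt.2 fun t =>
      (differentiableAt_riemannZeta (s := c + t * I + 2 * ((0 : ℤ) : ℂ) + 1) (by
        intro h
        have := congrArg Complex.re h
        rw [hre'] at this
        simp at this
        linarith)).continuousAt.comp
        (f := fun t : ℝ => (c : ℂ) + t * I + 2 * ((0 : ℤ) : ℂ) + 1) (by fun_prop)
    refine Continuous.inv₀ (by fun_prop) fun t => ?_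
    exact mul_ne_zero (mul_ne_zero two_ne_zero (pow_ne_zero 2 (hne _ (by rw [hre]; exact hc))))
      (pow_ne_zero 2 (hne _ (by rw [hre']; linarith)))
  · refine Filter.Eventually.of_forall fun t => ?_
    rw [norm_inv, norm_mul, norm_mul, norm_pow, norm_pow, Complex.norm_two]
    have b1 := two_sub_le_norm_riemannZeta (s := c + t * I) (by rw [hre]; exact hc)
    have b2 := two_sub_le_norm_riemannZeta (s := c + t * I + 2 * ((0 : ℤ) : ℂ) + 1)
      (by rw [hre']; linarith)
    gcongr

open Complex LSeries in
/-- The Dirichlet series of the divisor function. -/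
lemma hasSum_divisorCount_mul_cpow {s : ℂ} (hs : 1 < s.re) :
    HasSum (fun n : ℕ+ => (divisorCount n : ℂ) * ((n : ℕ) : ℂ) ^ (-s)) (riemannZeta s ^ 2) := by
  have h1 := LSeriesHasSum_one hs
  have h2 := h1.convolution h1
  have h3 : HasSum (LSeries.term (LSeries.convolution 1 1) s) (riemannZeta s ^ 2) := by
    rw [pow_two]; exact h2
  have h4 := (Function.Injective.hasSum_iff PNat.coe_injective (f := LSeries.term
    (LSeries.convolution 1 1) s) (a := riemannZeta s ^ 2) (fun n hn => by
      have : n = 0 := by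
        by_contra h
        exact hn ⟨⟨n, Nat.pos_of_ne_zero h⟩, rfl⟩
      rw [this, LSeries.term_zero])).2 h3
  refine h4.congr_fun ?_
  intro n
  have hcard : LSeries.convolution 1 1 (n : ℕ) = (divisorCount n : ℂ) := by
    rw [LSeries.convolution_def, divisorCount]
    simp [← Nat.map_div_right_divisors]
  rw [Function.comp_apply, LSeries.term_of_ne_zero n.ne_zero, hcard, cpow_neg, div_eq_mul_inv]

lemma summable_divisorCount_mul_rpow {c : ℝ} (hc : 1 < c) :
    Summable fun n : ℕ+ => (divisorCount n : ℝ) * ((n : ℕ) : ℝ) ^ (-c) := by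
  refine (hasSum_divisorCount_mul_cpow (s := c) (by simpa using hc)).summable.norm.congr fun n => ?_
  rw [norm_mul, Complex.norm_natCast, Complex.norm_natCast_cpow_of_pos n.pos]
  simp

open Complex in
/-- Mellin inversion for `X ↦ K₀(4πε√X) + K₀(4πε̄√X)`. -/
lemma koshliakovKernel_eq_integral {c : ℝ} (hc : 2 ≤ c) (hcZ : ∀ k : ℤ, c ≠ k) {X : ℝ}
    (hX : 0 < X) : (2 * Real.pi : ℂ) * koshliakovKernel X =
      ∫ y : ℝ, (X : ℂ) ^ (-((c : ℂ) + y * I)) * mellin koshliakovKernel (c + y * I) := by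
  have h := mellinInv_mellin_eq c koshliakovKernel hX
    (mellin_koshliakovKernel (w := c) (by rw [ofReal_re]; linarith)).1
    (verticalIntegrable_mellin_koshliakovKernel hc hcZ) (continuousAt_koshliakovKernel hX)
  rw [← h, mellinInv, real_smul]
  have hp : (Real.pi : ℂ) ≠ 0 := ofReal_ne_zero.2 Real.pi_ne_zero
  push_cast
  simp only [smul_eq_mul]
  rw [← mul_assoc, mul_one_div_cancel (mul_ne_zero two_ne_zero hp), one_mul]

open Complex in
-- Taking absolute values in the inversion integral gives decay of order `X^(-c)`, enough for the
-- absolute convergence of the series of `Ω_ρ`.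
lemma exists_norm_koshliakovKernel_le {c : ℝ} (hc : 2 ≤ c) (hcZ : ∀ k : ℤ, c ≠ k) :
    ∃ K : ℝ, ∀ X : ℝ, 0 < X → ‖koshliakovKernel X‖ ≤ K * X ^ (-c) := by
  have hI := verticalIntegrable_mellin_koshliakovKernel hc hcZ
  refine ⟨(∫ y : ℝ, ‖mellin koshliakovKernel (c + y * I)‖) / (2 * Real.pi), fun X hX => ?_⟩
  have hp : 0 < 2 * Real.pi := by positivity
  have h := congrArg norm (koshliakovKernel_eq_integral hc hcZ hX)
  have e : ‖(2 * Real.pi : ℂ)‖ = 2 * Real.pi := by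
    rw [show (2 * Real.pi : ℂ) = ((2 * Real.pi : ℝ) : ℂ) by push_cast; rfl, norm_real,
      Real.norm_of_nonneg hp.le]
  rw [norm_mul, e] at h
  rw [div_mul_eq_mul_div, le_div_iff₀ hp, mul_comm, h]
  refine (MeasureTheory.norm_integral_le_integral_norm _).trans_eq ?_
  rw [← MeasureTheory.integral_mul_const]
  refine MeasureTheory.integral_congr_ae (Filter.Eventually.of_forall fun y => ?_)
  simp only
  rw [norm_mul, norm_cpow_eq_rpow_re_of_pos hX, mul_comm]
  simp

/-- The parameter `ρ` only rescales the argument, so one kernel, with `ρ = π`, serves for all;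
`ρ²/π²` becomes the `λ` of the contour integral. -/
lemma koshliakovTerm_eq {ρ : ℝ} (hρ : 0 < ρ) (x : ℝ) (j : ℕ+) :
    koshliakovTerm ρ x j =
      divisorCount j * koshliakovKernel (ρ ^ 2 / Real.pi ^ 2 * x * (j : ℕ)) := by
  have hp := Real.pi_pos
  have h : Real.sqrt (ρ ^ 2 / Real.pi ^ 2 * x * (j : ℕ)) =
      ρ / Real.pi * Real.sqrt ((j : ℕ) * x) := by
    rw [show ρ ^ 2 / Real.pi ^ 2 * x * (j : ℕ) = (ρ / Real.pi) ^ 2 * ((j : ℕ) * x) by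
      rw [div_pow]; ring, Real.sqrt_mul (sq_nonneg _), Real.sqrt_sq (by positivity)]
  have hpc : (Real.pi : ℂ) ≠ 0 := Complex.ofReal_ne_zero.2 hp.ne'
  rw [koshliakovTerm, koshliakovKernel, h]
  have e : ∀ a : ℂ, 4 * (Real.pi : ℂ) * a * ((ρ / Real.pi * Real.sqrt ((j : ℕ) * x) : ℝ) : ℂ) =
      4 * (ρ : ℂ) * a * (Real.sqrt ((j : ℕ) * x) : ℝ) := fun a => by
    push_cast
    field_simp
  rw [e, e]

lemma summable_koshliakovTerm {ρ x : ℝ} (hρ : 0 < ρ) (hx : 0 < x) :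
    Summable (koshliakovTerm ρ x) := by
  have hc : ∀ k : ℤ, (5 / 2 : ℝ) ≠ k := fun k h => by
    have h1 : (5 : ℝ) = 2 * k := by linarith
    have h2 : (5 : ℤ) = 2 * k := by exact_mod_cast h1
    omega
  obtain ⟨K, hK⟩ := exists_norm_koshliakovKernel_le (c := 5 / 2) (by norm_num) hc
  have hl : 0 < ρ ^ 2 / Real.pi ^ 2 * x := by have := Real.pi_pos; positivity
  refine Summable.of_norm_bounded ((summable_divisorCount_mul_rpow
    (c := 5 / 2) (by norm_num)).mul_left (K * (ρ ^ 2 / Real.pi ^ 2 * x) ^ (-(5 / 2) : ℝ))) fun j => ?_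
  have hj : (0 : ℝ) < (j : ℕ) := by exact_mod_cast j.pos
  rw [koshliakovTerm_eq hρ, norm_mul, Complex.norm_natCast]
  calc _ ≤ (divisorCount j : ℝ) * (K * (ρ ^ 2 / Real.pi ^ 2 * x * (j : ℕ)) ^ (-(5 / 2) : ℝ)) := by
        gcongr
        exact hK _ (by positivity)
    _ = _ := by
        rw [Real.mul_rpow hl.le hj.le]
        ring

open Complex MeasureTheory in
/-- The series `∑ d(n) Ω_ρ(n) / n^(2m+1)` as a Mellin–Barnes integral. -/
theorem hasSum_dixitGuptaTerm (m : ℤ) {ρ c : ℝ} (hρ : 0 < ρ) (hc : 2 ≤ c) (hcZ : ∀ k : ℤ, c ≠ k)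
    (hcm : -(2 * m) < c) : HasSum (dixitGuptaTerm m ρ)
      ((2 * Real.pi : ℂ)⁻¹ * ∫ y : ℝ, spectralKernel m (ρ ^ 2 / Real.pi ^ 2) (c + y * I)) := by
  set lam : ℝ := ρ ^ 2 / Real.pi ^ 2 with hlam
  have hpi := Real.pi_pos
  have hl : 0 < lam := by positivity
  have hlc : (lam : ℂ) ≠ 0 := ofReal_ne_zero.2 hl.ne'
  set k : ℂ → ℂ := mellin koshliakovKernel
  have hk : Integrable fun y : ℝ => k (c + y * I) :=
    verticalIntegrable_mellin_koshliakovKernel hc hcZ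
  have hre : ∀ y : ℝ, ((c : ℂ) + y * I).re = c := fun y => by simp
  have hre' : ∀ y : ℝ, ((c : ℂ) + y * I + 2 * m + 1).re = c + 2 * m + 1 := fun y => by
    have e : (c : ℂ) + y * I + 2 * m + 1 = ((c + 2 * m + 1 : ℝ) : ℂ) + y * I := by push_cast; ring
    rw [e]; simp
  -- The pair `(n, j)` indexes the double series. On the line, the norm of `g p y` does not depend
  -- on `y`, so integrability and summability reduce to that of the Mellin transform and to two
  -- Dirichlet series with exponents `c + 2m + 1` and `c`, both greater than `1`.
  set g : ℕ+ × ℕ+ → ℝ → ℂ := fun p y => 2 * (lam : ℂ) ^ (-((c : ℂ) + y * I)) *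
    (((divisorCount p.1 : ℂ) * ((p.1 : ℕ) : ℂ) ^ (-((c : ℂ) + y * I + 2 * m + 1))) *
      ((divisorCount p.2 : ℂ) * ((p.2 : ℕ) : ℂ) ^ (-((c : ℂ) + y * I)))) with hg
  set F : ℕ+ × ℕ+ → ℝ → ℂ := fun p y => g p y * k (c + y * I) with hF
  have hgn : ∀ p y, ‖g p y‖ = 2 * lam ^ (-c) *
      (((divisorCount p.1 : ℝ) * ((p.1 : ℕ) : ℝ) ^ (-(c + 2 * m + 1))) *
        ((divisorCount p.2 : ℝ) * ((p.2 : ℕ) : ℝ) ^ (-c))) := by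
    intro p y
    simp only [hg, norm_mul, Complex.norm_natCast, Complex.norm_two,
      Complex.norm_natCast_cpow_of_pos p.1.pos, Complex.norm_natCast_cpow_of_pos p.2.pos,
      norm_cpow_eq_rpow_re_of_pos hl, neg_re, hre, hre']
  have hnc : ∀ n : ℕ+, ((n : ℕ) : ℂ) ≠ 0 := fun n => Nat.cast_ne_zero.2 n.ne_zero
  have hgc : ∀ p, Continuous (g p) := by
    intro p
    have c1 : ∀ (a : ℂ) (f : ℝ → ℂ), a ≠ 0 → Continuous f → Continuous fun y => a ^ f y :=
      fun a f ha hf => hf.const_cpow (Or.inl ha)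
    have := c1 lam (fun y => -((c : ℂ) + y * I)) hlc (by fun_prop)
    have := c1 _ (fun y => -((c : ℂ) + y * I + 2 * m + 1)) (hnc p.1) (by fun_prop)
    have := c1 _ (fun y => -((c : ℂ) + y * I)) (hnc p.2) (by fun_prop)
    simp only [hg]
    fun_prop
  have hFi : ∀ p, Integrable (F p) := fun p =>
    hk.bdd_mul (hgc p).aestronglyMeasurable (Filter.Eventually.of_forall fun y => (hgn p y).le)
  have hsum : Summable fun p : ℕ+ × ℕ+ => ∫ y : ℝ, ‖F p y‖ := by
    have hs : Summable fun p : ℕ+ × ℕ+ =>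
        ((divisorCount p.1 : ℝ) * ((p.1 : ℕ) : ℝ) ^ (-(c + 2 * m + 1))) *
        ((divisorCount p.2 : ℝ) * ((p.2 : ℕ) : ℝ) ^ (-c)) :=
      (summable_divisorCount_mul_rpow (by linarith)).mul_of_nonneg
        (summable_divisorCount_mul_rpow (by linarith)) (fun n => by positivity)
        (fun n => by positivity)
    refine (hs.mul_left (2 * lam ^ (-c) * ∫ y : ℝ, ‖k (c + y * I)‖)).congr fun p => ?_
    simp only [hF, norm_mul, hgn]
    rw [integral_const_mul]
    ring
  have hS := hasSum_integral_of_summable_integral_norm hFi hsum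
  have htsum : ∀ y : ℝ, ∑' p, F p y = spectralKernel m lam (c + y * I) := by
    intro y
    have h1 := hasSum_divisorCount_mul_cpow (s := (c : ℂ) + y * I + 2 * m + 1)
      (by rw [hre']; linarith)
    have h2 := hasSum_divisorCount_mul_cpow (s := (c : ℂ) + y * I) (by rw [hre]; linarith)
    have hs12 := summable_mul_of_summable_norm
      (f := fun n : ℕ+ => (divisorCount n : ℂ) * ((n : ℕ) : ℂ) ^ (-((c : ℂ) + y * I + 2 * m + 1)))
      (g := fun n : ℕ+ => (divisorCount n : ℂ) * ((n : ℕ) : ℂ) ^ (-((c : ℂ) + y * I)))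
      h1.summable.norm h2.summable.norm
    have h3 := h1.mul h2 hs12
    have h4 := (h3.mul_left (2 * (lam : ℂ) ^ (-((c : ℂ) + y * I)))).mul_right (k (c + y * I))
    refine h4.tsum_eq.trans ?_
    have h5 := mellin_koshliakovKernel_mul_riemannZeta_sq (w := c + y * I)
      (by rw [hre]; linarith) (cos_pi_mul_div_two_ne_zero fun k => by
        have := ne_intCast_of_re hcZ y (2 * k + 1)
        push_cast at this
        exact this)
    rw [spectralKernel]
    linear_combination ((lam : ℂ) ^ (-((c : ℂ) + y * I)) *
      riemannZeta (c + y * I + 2 * m + 1) ^ 2) * h5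
  simp only [htsum] at hS
  have hS' := hS.mul_left (2 * Real.pi : ℂ)⁻¹
  -- Absolute convergence over pairs allows summing over `j` first; the inner sum is Mellin
  -- inversion term by term and rebuilds `Ω_ρ(n)`.
  suffices hfib : ∀ n, HasSum (fun j => (2 * Real.pi : ℂ)⁻¹ * ∫ y : ℝ, F (n, j) y)
      (dixitGuptaTerm m ρ n) from hS'.prod_fiberwise hfib
  intro n
  have hn : (0 : ℝ) < (n : ℕ) := by exact_mod_cast n.pos
  have hT := ((summable_koshliakovTerm hρ hn).hasSum.mul_left
    (2 * (divisorCount n : ℂ) / ((n : ℕ) : ℂ) ^ (2 * m + 1)))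
  have hval : 2 * (divisorCount n : ℂ) / ((n : ℕ) : ℂ) ^ (2 * m + 1) *
      ∑' j, koshliakovTerm ρ (n : ℕ) j = dixitGuptaTerm m ρ n := by
    rw [dixitGuptaTerm, koshliakovOmega]
    ring
  rw [hval] at hT
  refine hT.congr_fun fun j => ?_
  have hj : (0 : ℝ) < (j : ℕ) := by exact_mod_cast j.pos
  have hFe : ∀ y, F (n, j) y = (2 * (divisorCount n : ℂ) * divisorCount j /
      ((n : ℕ) : ℂ) ^ (2 * m + 1)) * (((lam * (n : ℕ) * (j : ℕ) : ℝ) : ℂ) ^ (-((c : ℂ) + y * I)) *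
        k (c + y * I)) := by
    intro y
    have e1 : ((lam * (n : ℕ) * (j : ℕ) : ℝ) : ℂ) ^ (-((c : ℂ) + y * I)) =
        (lam : ℂ) ^ (-((c : ℂ) + y * I)) * ((n : ℕ) : ℂ) ^ (-((c : ℂ) + y * I)) *
          ((j : ℕ) : ℂ) ^ (-((c : ℂ) + y * I)) := by
      rw [ofReal_mul, mul_cpow_ofReal_nonneg (by positivity) hj.le, ofReal_mul,
        mul_cpow_ofReal_nonneg hl.le hn.le]
      simp
    have e2 : ((n : ℕ) : ℂ) ^ (-((c : ℂ) + y * I + 2 * m + 1)) =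
        ((n : ℕ) : ℂ) ^ (-((c : ℂ) + y * I)) / ((n : ℕ) : ℂ) ^ (2 * m + 1) := by
      rw [← cpow_intCast, ← cpow_sub _ _ (hnc n)]
      congr 1
      push_cast
      ring
    simp only [hF, hg]
    rw [e1, e2]
    ring
  simp only [hFe]
  rw [integral_const_mul, ← koshliakovKernel_eq_integral hc hcZ (by positivity),
    koshliakovTerm_eq hρ, ← hlam]
  have hp : (Real.pi : ℂ) ≠ 0 := ofReal_ne_zero.2 hpi.ne'
  field_simp

/-! ### Reflection and residues of the contour integral -/

lemma intCast_add_half_ne (p : ℤ) (k : ℤ) : (p : ℝ) + 1 / 2 ≠ k := fun h => by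
  have h1 : (2 * p + 1 : ℝ) = 2 * k := by linarith
  have h2 : 2 * p + 1 = 2 * k := by exact_mod_cast h1
  omega

lemma ne_intCast_of_abs_re_sub_lt {p : ℤ} {w : ℂ} (hw : |w.re - (p : ℝ)| < 1) {k : ℤ}
    (hk : k ≠ p) : w ≠ k := by
  rintro rfl
  rw [Complex.intCast_re] at hw
  have h1 : |k - p| < 1 := by exact_mod_cast hw
  rw [Int.abs_lt_one_iff] at h1
  omega

/-- The integral of `spectralKernel` over the vertical line of abscissa `σ`. -/
noncomputable def spectralIntegral (m : ℤ) (lam σ : ℝ) : ℂ :=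
  ∫ t : ℝ, spectralKernel m lam (σ + t * Complex.I)

open Complex in
-- All poles are at integers and of order at most two, so each unit step between half-integer lines
-- crosses a single candidate `p`; its residue is the derivative of `(w-p)²` times the kernel.
lemma spectralIntegral_sub {m : ℤ} {lam : ℝ} (hl : 0 < lam) (p : ℤ) {U : ℂ → ℂ}
    (hU : ∀ w : ℂ, |w.re - (p : ℝ)| < 1 → DifferentiableAt ℂ U w)
    (hf : ∀ w : ℂ, w ≠ p → |w.re - (p : ℝ)| < 1 → spectralKernel m lam w = U w / (w - p) ^ 2) :
    spectralIntegral m lam (p + 1 / 2) - spectralIntegral m lam (p - 1 / 2) =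
      2 * Real.pi * deriv U p := by
  obtain ⟨C, hC⟩ := exists_norm_spectralKernel_le m hl (|(p : ℝ)| + 1)
  have h2 : ∀ k : ℤ, (p : ℝ) - 1 / 2 ≠ k := fun k => by
    have := intCast_add_half_ne (p - 1) k
    push_cast at this
    intro h
    exact this (by linarith)
  have h := integral_vertical_sub_integral_vertical (U := U) (f := spectralKernel m lam)
    (p := p) (C := |C|) (fun w hw => (hU w hw).differentiableWithinAt)
    (fun w hw hw' => by simpa using hf w (by simpa using hw) hw')
    (integrable_spectralKernel m hl (intCast_add_half_ne p)) (integrable_spectralKernel m hl h2)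
    (fun w hw hi => by
      have h3 : |w.re| ≤ |(p : ℝ)| + 1 := by
        have := abs_sub_abs_le_abs_sub w.re (p : ℝ)
        linarith
      refine (hC w h3 hi).trans ?_
      have h4 : 0 < |w.im| := by linarith
      calc C / |w.im| ^ 2 ≤ |C| / |w.im| ^ 2 := by gcongr; exact le_abs_self C
        _ ≤ |C| / |w.im| := by
          gcongr
          nlinarith)
  rw [ofReal_intCast] at h
  exact h

open Complex in
lemma spectralIntegral_reflect (m : ℤ) {lam : ℝ} (hl : 0 < lam) (c : ℝ) :
    spectralIntegral m lam (-2 * m - c) =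
      (-1) ^ m * (lam : ℂ) ^ (2 * m) * spectralIntegral m lam⁻¹ c := by
  have hlc : (lam : ℂ) ≠ 0 := ofReal_ne_zero.2 hl.ne'
  -- The reflection swaps `1 - w` with `w + 2m + 1` and shifts the argument of the cosine by `mπ`,
  -- up to sign.
  have key : ∀ w : ℂ, spectralKernel m lam (-2 * m - w) =
      (-1) ^ m * (lam : ℂ) ^ (2 * m) * spectralKernel m lam⁻¹ w := by
    intro w
    have e1 : 1 - (-2 * (m : ℂ) - w) = w + 2 * m + 1 := by ring
    have e2 : -2 * (m : ℂ) - w + 2 * m + 1 = 1 - w := by ring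
    have e3 : (lam : ℂ) ^ (-(-2 * (m : ℂ) - w)) = (lam : ℂ) ^ (2 * m) * (lam : ℂ) ^ w := by
      rw [← cpow_intCast, ← cpow_add _ _ hlc]
      congr 1
      push_cast
      ring
    have e4 : ((lam⁻¹ : ℝ) : ℂ) ^ (-w) = (lam : ℂ) ^ w := by
      rw [ofReal_inv, inv_cpow _ _ (by
        rw [arg_ofReal_of_nonneg hl.le]; exact Real.pi_pos.ne), cpow_neg, inv_inv]
    have e5 : cos (Real.pi * (-2 * (m : ℂ) - w) / 2) = (-1) ^ m * cos (Real.pi * w / 2) := by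
      have : Real.pi * (-2 * (m : ℂ) - w) / 2 = -(Real.pi * w / 2 + m * Real.pi) := by ring
      have hc : cos ((m : ℂ) * Real.pi) = (-1) ^ m := by
        have := congrArg ofReal (Real.cos_int_mul_pi m)
        push_cast at this
        exact this
      rw [this, cos_neg, cos_add, sin_int_mul_pi, hc]
      ring
    have e6 : ((-1 : ℂ) ^ m) * (-1) ^ m = 1 := by
      rw [← mul_zpow]; norm_num
    have e7 : ((-1 : ℂ) ^ m)⁻¹ = (-1) ^ m := inv_eq_of_mul_eq_one_left e6
    rw [spectralKernel, spectralKernel, e1, e2, e3, e4, e5]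
    rw [mul_left_comm (2 : ℂ), div_eq_mul_inv, mul_inv, e7]
    ring
  have h : ∀ t : ℝ, spectralKernel m lam (((-2 * m - c : ℝ) : ℂ) + t * I) =
      (-1) ^ m * (lam : ℂ) ^ (2 * m) * spectralKernel m lam⁻¹ (c + (-t : ℝ) * I) := by
    intro t
    rw [← key]
    congr 1
    push_cast
    ring
  rw [spectralIntegral]
  simp only [h]
  rw [MeasureTheory.integral_const_mul,
    MeasureTheory.integral_neg_eq_self fun t : ℝ => spectralKernel m lam⁻¹ (c + t * I)]
  rfl

/-- The residue of `spectralKernel` at an odd integer, and `0` at an even integer. -/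
noncomputable def oddResidue (m : ℤ) (lam : ℝ) (p : ℤ) : ℂ :=
  if Odd p then
    -(riemannZeta (1 - p) ^ 2 * riemannZeta (p + 2 * m + 1) ^ 2 * (lam : ℂ) ^ (-p)) /
      (Real.pi * Complex.sin (Real.pi * p / 2))
  else 0

open Complex in
-- The cosine has a simple zero at `p` and no other zero within distance one, so its divided
-- difference is nonvanishing in the strip. Both zeta poles are at even integers and do not
-- interfere.
lemma spectralIntegral_sub_of_odd (m : ℤ) {lam : ℝ} (hl : 0 < lam) {p : ℤ} (hp : Odd p) :
    spectralIntegral m lam (p + 1 / 2) - spectralIntegral m lam (p - 1 / 2) =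
      2 * Real.pi * oddResidue m lam p := by
  have hpi : (Real.pi : ℂ) ≠ 0 := ofReal_ne_zero.2 Real.pi_ne_zero
  obtain ⟨q, hq⟩ := hp
  have hd : ∀ w : ℂ, HasDerivAt (fun w : ℂ => 2 * cos (Real.pi * w / 2))
      (2 * (-sin (Real.pi * w / 2) * (Real.pi * 1 / 2))) w := fun w =>
    ((((hasDerivAt_id w).const_mul (Real.pi : ℂ)).div_const 2).ccos).const_mul 2
  set g : ℂ → ℂ := fun w => 2 * cos (Real.pi * w / 2)
  have hg0 : g p = 0 := by
    have : (Real.pi : ℂ) * (p : ℤ) / 2 = (2 * q + 1) * Real.pi / 2 := by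
      rw [hq]; push_cast; ring
    simp only [g]
    rw [this, mul_eq_zero]
    right
    exact cos_eq_zero_iff.2 ⟨q, rfl⟩
  have hsin : sin (Real.pi * p / 2) ≠ 0 := by
    intro h
    have h1 := sin_sq_add_cos_sq ((Real.pi : ℂ) * p / 2)
    have h2 : cos ((Real.pi : ℂ) * p / 2) = 0 := by
      simpa [g] using hg0
    rw [h, h2] at h1
    norm_num at h1
  have hG : Differentiable ℂ (dslope g p) := by
    rw [← differentiableOn_univ]
    exact (Complex.differentiableOn_dslope Filter.univ_mem).2
      fun w _ => (hd w).differentiableAt.differentiableWithinAt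
  have hGp : dslope g p p = -(Real.pi * sin (Real.pi * p / 2)) := by
    rw [dslope_same, (hd p).deriv]; ring
  have hGne : ∀ w : ℂ, w ≠ p → dslope g p w = g w / (w - p) := fun w hw => by
    rw [dslope_of_ne _ hw, slope_def_field, hg0, sub_zero]
  have hG0 : ∀ w : ℂ, |w.re - (p : ℝ)| < 1 → dslope g p w ≠ 0 := by
    intro w hw
    by_cases h : w = p
    · rw [h, hGp, neg_ne_zero]
      exact mul_ne_zero hpi hsin
    · rw [hGne w h]
      refine div_ne_zero (mul_ne_zero two_ne_zero (cos_pi_mul_div_two_ne_zero fun k => ?_))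
        (sub_ne_zero.2 h)
      by_cases hk : 2 * k + 1 = p
      · rw [← hk] at h
        push_cast at h
        exact h
      · have := ne_intCast_of_abs_re_sub_lt hw hk
        push_cast at this
        exact this
  set h : ℂ → ℂ := fun w => riemannZeta (1 - w) ^ 2 * riemannZeta (w + 2 * m + 1) ^ 2 *
    (lam : ℂ) ^ (-w) / dslope g p w with hh
  have hhd : ∀ w : ℂ, |w.re - (p : ℝ)| < 1 → DifferentiableAt ℂ h w := by
    intro w hw
    have d1 : DifferentiableAt ℂ (fun w : ℂ => riemannZeta (1 - w)) w :=
      (differentiableAt_riemannZeta (s := 1 - w) (by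
        intro h
        exact ne_intCast_of_abs_re_sub_lt hw (k := 0) (by omega) (by
          push_cast; linear_combination -h))).comp w (by fun_prop)
    have d2 : DifferentiableAt ℂ (fun w : ℂ => riemannZeta (w + 2 * m + 1)) w :=
      (differentiableAt_riemannZeta (s := w + 2 * m + 1) (by
        intro h
        exact ne_intCast_of_abs_re_sub_lt hw (k := -2 * m) (by omega) (by
          push_cast; linear_combination h))).comp w (by fun_prop)
    have d3 : DifferentiableAt ℂ (fun w : ℂ => (lam : ℂ) ^ (-w)) w :=
      DifferentiableAt.const_cpow (by fun_prop) (Or.inl (ofReal_ne_zero.2 hl.ne'))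
    exact (((d1.pow 2).mul (d2.pow 2)).mul d3).div (hG w) (hG0 w hw)
  have hpp : |((p : ℂ)).re - (p : ℝ)| < 1 := by simp
  rw [spectralIntegral_sub hl p (U := fun w => (w - p) * h w)
    (fun w hw => DifferentiableAt.mul (by fun_prop) (hhd w hw)) (fun w hw hw' => by
      have h1 := hG0 w hw'
      have h2 := sub_ne_zero.2 hw
      have h3 : g w = dslope g p w * (w - p) := by
        rw [hGne w hw]; field_simp
      rw [spectralKernel]
      change _ / g w = _
      rw [h3, hh]
      field_simp)]
  have hder : HasDerivAt (fun w : ℂ => (w - p) * h w) (1 * h p + ((p : ℂ) - p) * deriv h p) p :=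
    ((hasDerivAt_id (p : ℂ)).sub_const _).mul (hhd p hpp).hasDerivAt
  rw [hder.deriv, oddResidue, if_pos ⟨q, hq⟩]
  have e : h p = -(riemannZeta (1 - p) ^ 2 * riemannZeta (p + 2 * m + 1) ^ 2 *
      (lam : ℂ) ^ (-p)) / (Real.pi * sin (Real.pi * p / 2)) := by
    simp only [hh]
    rw [hGp, div_neg, neg_div, ← cpow_intCast]
    push_cast
    rfl
  rw [e]
  ring

open Complex in
lemma spectralIntegral_sub_of_even (m : ℤ) {lam : ℝ} (hl : 0 < lam) {p : ℤ} (hp : Even p)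
    (h0 : p ≠ 0) (hpm : p ≠ -2 * m) :
    spectralIntegral m lam (p + 1 / 2) - spectralIntegral m lam (p - 1 / 2) = 0 := by
  have hd : ∀ w : ℂ, |w.re - (p : ℝ)| < 1 → DifferentiableAt ℂ (spectralKernel m lam) w := by
    intro w hw
    refine differentiableAt_spectralKernel m hl ?_ ?_ fun k => ?_
    · simpa using ne_intCast_of_abs_re_sub_lt hw (k := 0) h0.symm
    · have := ne_intCast_of_abs_re_sub_lt hw (k := -2 * m) hpm.symm
      push_cast at this
      rwa [neg_mul] at this
    · have := ne_intCast_of_abs_re_sub_lt hw (k := 2 * k + 1) (by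
        rintro rfl
        exact Int.not_even_two_mul_add_one k hp)
      push_cast at this
      exact this
  rw [spectralIntegral_sub hl p (U := fun w => (w - p) ^ 2 * spectralKernel m lam w)
    (fun w hw => DifferentiableAt.mul (by fun_prop) (hd w hw)) (fun w hw _ => by
      have := sub_ne_zero.2 hw
      field_simp)]
  have hder : HasDerivAt (fun w : ℂ => (w - p) ^ 2 * spectralKernel m lam w) _ p :=
    (((hasDerivAt_id (p : ℂ)).sub_const (p : ℂ)).pow 2).mul
      (hd p (by simp)).hasDerivAt
  rw [hder.deriv]
  simp

open Complex in
-- The double pole comes from `ζ(1-w)² = riemannZeta₁(1-w)² / w²`. The value `1` and derivative `γ`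
-- of `riemannZeta₁` at `1` give Euler's constant, and `λ^(-w)` gives the logarithm.
lemma spectralIntegral_sub_zero {m : ℤ} (hm : m ≠ 0) {lam : ℝ} (hl : 0 < lam) :
    spectralIntegral m lam (((0 : ℤ) : ℝ) + 1 / 2) - spectralIntegral m lam (((0 : ℤ) : ℝ) - 1 / 2) =
      2 * Real.pi * (riemannZeta (2 * m + 1) * deriv riemannZeta (2 * m + 1) -
        riemannZeta (2 * m + 1) ^ 2 * (Real.eulerMascheroniConstant + Real.log lam / 2)) := by
  have hlc : (lam : ℂ) ≠ 0 := ofReal_ne_zero.2 hl.ne'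
  have hmc : (m : ℂ) ≠ 0 := Int.cast_ne_zero.2 hm
  have dZ : ∀ w : ℂ, HasDerivAt (fun w : ℂ => riemannZeta₁ (1 - w))
      (deriv riemannZeta₁ (1 - w) * (0 - 1)) w := fun w =>
    HasDerivAt.comp (h₂ := riemannZeta₁) (h := fun w : ℂ => 1 - w) w
      (differentiable_riemannZeta₁ (1 - w)).hasDerivAt
      ((hasDerivAt_const w (1 : ℂ)).sub (hasDerivAt_id w))
  have dz : ∀ w : ℂ, w ≠ -2 * m → HasDerivAt (fun w : ℂ => riemannZeta (w + 2 * m + 1))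
      (deriv riemannZeta (w + 2 * m + 1) * 1) w := fun w hw =>
    HasDerivAt.comp (h₂ := riemannZeta) (h := fun w : ℂ => w + 2 * m + 1) w
      (differentiableAt_riemannZeta (by
        intro h; exact hw (by linear_combination h))).hasDerivAt
      (((hasDerivAt_id w).add_const _).add_const _)
  have dl : ∀ w : ℂ, HasDerivAt (fun w : ℂ => (lam : ℂ) ^ (-w))
      ((lam : ℂ) ^ (-w) * log lam * (-1)) w := fun w =>
    (hasDerivAt_id w).neg.const_cpow (Or.inl hlc)
  have dc : ∀ w : ℂ, HasDerivAt (fun w : ℂ => 2 * cos (Real.pi * w / 2))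
      (2 * (-sin (Real.pi * w / 2) * (Real.pi * 1 / 2))) w := fun w =>
    ((((hasDerivAt_id w).const_mul (Real.pi : ℂ)).div_const 2).ccos).const_mul 2
  have hcos : ∀ w : ℂ, |w.re - ((0 : ℤ) : ℝ)| < 1 → 2 * cos (Real.pi * w / 2) ≠ 0 := fun w hw =>
    mul_ne_zero two_ne_zero (cos_pi_mul_div_two_ne_zero fun k => by
      have := ne_intCast_of_abs_re_sub_lt hw (k := 2 * k + 1) (by omega)
      push_cast at this
      exact this)
  have hwm : ∀ w : ℂ, |w.re - ((0 : ℤ) : ℝ)| < 1 → w ≠ -2 * m := fun w hw => by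
    have := ne_intCast_of_abs_re_sub_lt hw (k := -2 * m) (by omega)
    push_cast at this
    exact this
  have dU : ∀ w : ℂ, |w.re - ((0 : ℤ) : ℝ)| < 1 → HasDerivAt (fun w : ℂ =>
      riemannZeta₁ (1 - w) ^ 2 * riemannZeta (w + 2 * m + 1) ^ 2 * (lam : ℂ) ^ (-w) /
        (2 * cos (Real.pi * w / 2))) _ w := fun w hw =>
    ((((dZ w).pow 2).mul ((dz w (hwm w hw)).pow 2)).mul (dl w)).div (dc w) (hcos w hw)
  rw [spectralIntegral_sub hl 0 (fun w hw => (dU w hw).differentiableAt) (fun w hw _ => by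
    have hw0 : w ≠ 0 := by simpa using hw
    rw [spectralKernel, riemannZeta_eq_inv_sub_mul (s := 1 - w) (by
      intro h; exact hw0 (by linear_combination -h))]
    have e : (1 - w - 1)⁻¹ = -w⁻¹ := by rw [← inv_neg]; congr 1; ring
    rw [e]
    push_cast
    field_simp
    ring), (dU ((0 : ℤ) : ℂ) (by simp)).deriv]
  simp [deriv_riemannZeta₁_one, ← ofReal_log hl.le]
  ring

open Complex in
-- This step is the mirror image of the one at `0` with `λ` inverted, so no second residue
-- computation is needed.
lemma spectralIntegral_sub_neg_two_mul {m : ℤ} (hm : m ≠ 0) {lam : ℝ} (hl : 0 < lam) :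
    spectralIntegral m lam (((-2 * m : ℤ) : ℝ) + 1 / 2) -
      spectralIntegral m lam (((-2 * m : ℤ) : ℝ) - 1 / 2) =
      2 * Real.pi * ((-1) ^ m * (lam : ℂ) ^ (2 * m) *
        (riemannZeta (2 * m + 1) ^ 2 * (Real.eulerMascheroniConstant - Real.log lam / 2) -
          riemannZeta (2 * m + 1) * deriv riemannZeta (2 * m + 1))) := by
  have h1 := spectralIntegral_reflect m hl (1 / 2)
  have h2 := spectralIntegral_reflect m hl (-(1 / 2))
  have h3 := spectralIntegral_sub_zero hm (inv_pos.2 hl)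
  have e1 : ((-2 * m : ℤ) : ℝ) + 1 / 2 = -2 * m - -(1 / 2) := by push_cast; ring
  have e2 : ((-2 * m : ℤ) : ℝ) - 1 / 2 = -2 * m - 1 / 2 := by push_cast; ring
  have e3 : ((0 : ℤ) : ℝ) + 1 / 2 = 1 / 2 := by norm_num
  have e4 : ((0 : ℤ) : ℝ) - 1 / 2 = -(1 / 2) := by norm_num
  rw [e3, e4, Real.log_inv] at h3
  push_cast at h3
  rw [e1, e2, h1, h2]
  linear_combination (-((-1 : ℂ) ^ m * (lam : ℂ) ^ (2 * m))) * h3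

/-- For negative `m` the argument is a negative odd integer; the functional equation at `s = -2m ≥
2` expresses the value as a product of nonzero factors. -/
lemma riemannZeta_two_mul_int_add_one_ne_zero {m : ℤ} (hm : m ≠ 0) :
    riemannZeta (2 * m + 1) ≠ 0 := by
  rcases lt_or_gt_of_ne hm with h | h
  · have hk : (2 : ℝ) ≤ -(2 * m) := by
      have : (2 : ℤ) ≤ -(2 * m) := by omega
      exact_mod_cast this
    set s : ℂ := -(2 * m) with hs
    have hre : s.re = -(2 * m) := by simp [hs]
    have e : 2 * (m : ℂ) + 1 = 1 - s := by rw [hs]; ring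
    have hcos : Complex.cos (Real.pi * s / 2) ≠ 0 := by
      refine cos_pi_mul_div_two_ne_zero fun k hk => ?_
      have h1 : ((-(2 * m) : ℤ) : ℂ) = ((2 * k + 1 : ℤ) : ℂ) := by push_cast; exact hk
      have h2 : -(2 * m) = 2 * k + 1 := by exact_mod_cast h1
      omega
    have hpi : (2 * (Real.pi : ℂ)) ≠ 0 :=
      mul_ne_zero two_ne_zero (Complex.ofReal_ne_zero.2 Real.pi_ne_zero)
    rw [e, riemannZeta_one_sub (fun n hn => by
      rw [hn] at hre
      simp at hre
      linarith [(Nat.cast_nonneg n : (0 : ℝ) ≤ n)]) (fun h1 => by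
      rw [h1] at hre
      simp at hre
      linarith)]
    refine mul_ne_zero (mul_ne_zero (mul_ne_zero (mul_ne_zero two_ne_zero ?_) ?_) hcos) ?_
    · rw [Ne, Complex.cpow_eq_zero_iff]
      exact fun h => hpi h.1
    · exact Complex.Gamma_ne_zero_of_re_pos (by rw [hre]; linarith)
    · exact riemannZeta_ne_zero_of_one_lt_re (by rw [hre]; linarith)
  · refine riemannZeta_ne_zero_of_one_lt_re ?_
    have h1 : (1 : ℝ) ≤ m := by exact_mod_cast h
    simp
    linarith

lemma spectralIntegral_sub_eq (m : ℤ) (hm : m ≠ 0) {lam : ℝ} (hl : 0 < lam) (p : ℤ) :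
    spectralIntegral m lam (p + 1 / 2) - spectralIntegral m lam (p - 1 / 2) =
      2 * Real.pi * ((if p = 0 then (riemannZeta (2 * m + 1) * deriv riemannZeta (2 * m + 1) -
        riemannZeta (2 * m + 1) ^ 2 * (Real.eulerMascheroniConstant + Real.log lam / 2)) else 0) +
      (if p = -2 * m then ((-1) ^ m * (lam : ℂ) ^ (2 * m) *
        (riemannZeta (2 * m + 1) ^ 2 * (Real.eulerMascheroniConstant - Real.log lam / 2) -
          riemannZeta (2 * m + 1) * deriv riemannZeta (2 * m + 1))) else 0) +
      oddResidue m lam p) := by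
  by_cases h0 : p = 0
  · subst h0
    rw [spectralIntegral_sub_zero hm hl, if_pos rfl, if_neg (by omega), oddResidue,
      if_neg (by decide), add_zero, add_zero]
  by_cases h1 : p = -2 * m
  · subst h1
    rw [spectralIntegral_sub_neg_two_mul hm hl, if_neg h0, if_pos rfl, oddResidue,
      if_neg (by rw [Int.not_odd_iff_even]; exact ⟨-m, by ring⟩), zero_add, add_zero]
  rw [if_neg h0, if_neg h1, zero_add, zero_add]
  rcases Int.even_or_odd p with h | h
  · rw [spectralIntegral_sub_of_even m hl h h0 h1, oddResidue,
      if_neg (Int.not_odd_iff_even.2 h), mul_zero]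
  · exact spectralIntegral_sub_of_odd m hl h

/-- Trivial zeros: for odd `p ≥ 3` the factor `ζ(1-p)` vanishes, and for odd `p ≤ -2m-3` the factor
`ζ(p+2m+1)` does. -/
lemma oddResidue_eq_zero {m : ℤ} {lam : ℝ} {p : ℤ} (h : 1 < p ∨ p < -2 * m - 1) :
    oddResidue m lam p = 0 := by
  rw [oddResidue]
  split_ifs with hp
  · obtain ⟨q, rfl⟩ := hp
    rcases h with h | h
    · obtain ⟨k, rfl⟩ : ∃ k : ℕ, q = k + 1 := ⟨(q - 1).toNat, by omega⟩
      have e : (1 : ℂ) - ((2 * ((k : ℤ) + 1) + 1 : ℤ) : ℂ) = -2 * ((k : ℂ) + 1) := by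
        push_cast; ring
      rw [e, riemannZeta_neg_two_mul_nat_add_one]
      simp
    · obtain ⟨k, hk⟩ : ∃ k : ℕ, q + m + 1 = -(k + 1 : ℤ) := ⟨(-(q + m + 2)).toNat, by omega⟩
      have e : ((2 * q + 1 : ℤ) : ℂ) + 2 * m + 1 = -2 * ((k : ℂ) + 1) := by
        have := congrArg (Int.cast : ℤ → ℂ) hk
        push_cast at this ⊢
        linear_combination 2 * this
      rw [e, riemannZeta_neg_two_mul_nat_add_one]
      simp
  · rfl

/-! ### Bernoulli numbers and the final identity -/

/-- Squaring removes the sign in Euler's formula. The case `k = 0` is needed: `ζ(0)` occurs at both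
ends of the finite sum. -/
lemma riemannZeta_two_mul_nat_sq (k : ℕ) :
    riemannZeta (2 * k) ^ 2 =
      2 ^ (4 * k) * Real.pi ^ (4 * k) * (bernoulli (2 * k) : ℂ) ^ 2 /
        (4 * ((2 * k).factorial : ℂ) ^ 2) := by
  have h2 : (2 : ℂ) ^ (2 * (k : ℤ) - 1) = 2 ^ (2 * k) / 2 := by
    rw [zpow_sub₀ two_ne_zero, zpow_one]
    norm_cast
  have hf : ((2 * k).factorial : ℂ) ≠ 0 := Nat.cast_ne_zero.2 (Nat.factorial_ne_zero _)
  have hs : ((-1 : ℂ) ^ (k + 1)) ^ 2 = 1 := by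
    rw [← pow_mul, mul_comm, pow_mul]; norm_num
  rw [riemannZeta_two_mul_nat', h2, div_pow, mul_pow, mul_pow, mul_pow, hs]
  field_simp
  ring

open Complex in
lemma oddResidue_eq_finiteTerm {m : ℤ} {α β : ℝ} (hα : 0 < α) (hβ : 0 < β)
    (hαβ : α * β = Real.pi ^ 2) {i : ℕ} (hi : (i : ℤ) ≤ m + 1) :
    (α : ℂ) ^ (-2 * m) * oddResidue m (α / β) (1 - 2 * i) =
      -((2 : ℂ) ^ (4 * m) * Real.pi * (dixitGuptaFiniteTerm m α β i : ℂ)) := by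
  -- At `p = 1 - 2i` the zeta arguments are `2i` and `2l` with `i + l = m + 1`.
  obtain ⟨l, hl⟩ : ∃ l : ℕ, m = i + l - 1 := ⟨(m + 1 - i).toNat, by omega⟩
  have hpi : (Real.pi : ℂ) ≠ 0 := ofReal_ne_zero.2 Real.pi_ne_zero
  have hαc : (α : ℂ) ≠ 0 := ofReal_ne_zero.2 hα.ne'
  have hβc : (β : ℂ) ≠ 0 := ofReal_ne_zero.2 hβ.ne'
  have hαβc : (α : ℂ) * β = (Real.pi : ℂ) ^ 2 := by exact_mod_cast congrArg ofReal hαβ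
  have e1 : 1 - ((1 - 2 * (i : ℤ) : ℤ) : ℂ) = 2 * (i : ℕ) := by push_cast; ring
  have e2 : ((1 - 2 * (i : ℤ) : ℤ) : ℂ) + 2 * m + 1 = 2 * (l : ℕ) := by
    rw [hl]; push_cast; ring
  have e3 : sin (Real.pi * ((1 - 2 * (i : ℤ) : ℤ) : ℂ) / 2) = (-1) ^ i := by
    have : (Real.pi : ℂ) * ((1 - 2 * (i : ℤ) : ℤ) : ℂ) / 2 = Real.pi / 2 - i * Real.pi := by
      push_cast; ring
    rw [this, sin_pi_div_two_sub]
    have := congrArg ofReal (Real.cos_nat_mul_pi i)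
    push_cast at this
    exact this
  have e4 : (2 * m + 2 - 2 * (i : ℤ)).toNat = 2 * l := by omega
  have e5 : 2 * m + 2 - 2 * (i : ℤ) = 2 * (l : ℤ) := by omega
  have hodd : Odd (1 - 2 * (i : ℤ)) := ⟨-i, by ring⟩
  have hsgn : ((-1 : ℂ) ^ i) * (-1) ^ i = 1 := by rw [← mul_pow]; norm_num
  have hsg0 : ((-1 : ℂ) ^ i) ≠ 0 := pow_ne_zero _ (by norm_num)
  have hf1 : ((2 * i).factorial : ℂ) ≠ 0 := Nat.cast_ne_zero.2 (Nat.factorial_ne_zero _)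
  have hf2 : ((2 * l).factorial : ℂ) ≠ 0 := Nat.cast_ne_zero.2 (Nat.factorial_ne_zero _)
  have h2m : (2 : ℂ) ^ (4 * m) * 16 = 2 ^ (4 * i) * 2 ^ (4 * l) := by
    have : 4 * m = ((4 * i + 4 * l : ℕ) : ℤ) - 4 := by rw [hl]; push_cast; ring
    rw [this, zpow_sub₀ two_ne_zero, zpow_natCast, pow_add]
    norm_num
  -- Euler's formula contributes `π^(4i+4l) = (αβ)^(2i+2l)`, which converts the powers of `α/β` into
  -- the required monomial in `α` and `β`.
  have hpow : (α : ℂ) ^ (-2 * m) * ((α / β : ℝ) : ℂ) ^ (-(1 - 2 * (i : ℤ))) *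
      (Real.pi ^ (4 * i) * Real.pi ^ (4 * l)) =
      Real.pi ^ 2 * ((α : ℂ) ^ (2 * i) * (β : ℂ) ^ (2 * (l : ℤ))) := by
    have hp4 : (Real.pi : ℂ) ^ (4 * i) * Real.pi ^ (4 * l) = ((α : ℂ) * β) ^ (2 * i + 2 * l) := by
      rw [hαβc, ← pow_mul, ← pow_add]
      congr 1
      ring
    rw [hp4, ← hαβc]
    push_cast
    rw [← zpow_natCast ((α : ℂ) * β), ← zpow_natCast (α : ℂ), div_zpow, mul_zpow, div_eq_mul_inv,
      ← zpow_neg]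
    have a1 : (α : ℂ) ^ (-2 * m) * (α : ℂ) ^ (-(1 - 2 * (i : ℤ))) *
        (α : ℂ) ^ ((2 * i + 2 * l : ℕ) : ℤ) = α * (α : ℂ) ^ ((2 * i : ℕ) : ℤ) := by
      rw [← zpow_add₀ hαc, ← zpow_add₀ hαc, ← zpow_one_add₀ hαc]
      congr 1
      rw [hl]
      push_cast
      ring
    have a2 : (β : ℂ) ^ (-(-(1 - 2 * (i : ℤ)))) * (β : ℂ) ^ ((2 * i + 2 * l : ℕ) : ℤ) =
        β * (β : ℂ) ^ (2 * (l : ℤ)) := by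
      rw [← zpow_add₀ hβc, ← zpow_one_add₀ hβc]
      congr 1
      push_cast
      ring
    linear_combination ((β : ℂ) ^ (-(-(1 - 2 * (i : ℤ)))) * (β : ℂ) ^ ((2 * i + 2 * l : ℕ) : ℤ)) * a1 +
      (α * (α : ℂ) ^ ((2 * i : ℕ) : ℤ)) * a2
  rw [oddResidue, if_pos hodd, e1, e2, e3, riemannZeta_two_mul_nat_sq, riemannZeta_two_mul_nat_sq,
    dixitGuptaFiniteTerm, e4, e5]
  push_cast at hpow ⊢
  generalize (α : ℂ) ^ (-2 * m) = A, ((α : ℂ) / β) ^ (-(1 - 2 * (i : ℤ))) = Q,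
    (Real.pi : ℂ) ^ (4 * i) = P, (Real.pi : ℂ) ^ (4 * l) = R, (α : ℂ) ^ (2 * i) = X,
    (β : ℂ) ^ (2 * (l : ℤ)) = Y, (2 : ℂ) ^ (4 * m) = T, (2 : ℂ) ^ (4 * i) = U,
    (2 : ℂ) ^ (4 * l) = V, (-1 : ℂ) ^ i = s, ((2 * i).factorial : ℂ) = F,
    ((2 * l).factorial : ℂ) = G, (bernoulli (2 * i) : ℂ) = B, (bernoulli (2 * l) : ℂ) = C at *
  field_simp
  linear_combination (-(U * V * B ^ 2 * C ^ 2)) * hpow + Real.pi ^ 2 * X * Y * B ^ 2 * C ^ 2 * h2m +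
    16 * T * B ^ 2 * C ^ 2 * Real.pi ^ 2 * X * Y * hsgn

open Complex in
theorem corollary1p3 (m : ℤ) (hm : m ≠ 0) (α β : ℝ) (hα : 0 < α) (hβ : 0 < β)
    (hαβ : α * β = Real.pi ^ 2) :
    riemannZeta (2 * (m : ℂ) + 1) ≠ 0 ∧
    (∀ ρ : ℝ, 0 < ρ →
      (∀ x : ℝ, 0 < x → Summable (koshliakovTerm ρ x)) ∧ Summable (dixitGuptaTerm m ρ)) ∧
    (α : ℂ) ^ (-2 * m) * dixitGuptaBracket m α =
      (-1 : ℂ) ^ (-m) * (β : ℂ) ^ (-2 * m) * dixitGuptaBracket m β -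
        (2 : ℂ) ^ (4 * m) * (Real.pi : ℂ) *
          ∑ j ∈ Finset.range (m + 2).toNat, (dixitGuptaFiniteTerm m α β j : ℂ) := by
  have hz := riemannZeta_two_mul_int_add_one_ne_zero hm
  -- With `c = N + 1/2`, this choice puts every pole with nonzero residue strictly between `-2m - c`
  -- and `c`, for either sign of `m`, and meets the convergence conditions `c ≥ 2` and `c > -2m`.
  set N : ℤ := 2 * |m| + 1 with hN
  have hm1 := le_abs_self m
  have hm2 := neg_le_abs m
  have hm3 : 1 ≤ |m| := Int.one_le_abs hm
  set c : ℝ := N + 1 / 2 with hc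
  have hN3 : (3 : ℝ) ≤ N := by
    have : (3 : ℤ) ≤ N := by omega
    exact_mod_cast this
  have hc2 : 2 ≤ c := by rw [hc]; linarith
  have hcm : -(2 * (m : ℝ)) < c := by
    have h1 : -(2 * m) ≤ N := by omega
    have h2 : -(2 * (m : ℝ)) ≤ N := by exact_mod_cast h1
    rw [hc]
    linarith
  have hS : ∀ ρ : ℝ, 0 < ρ → HasSum (dixitGuptaTerm m ρ) _ := fun ρ hρ =>
    hasSum_dixitGuptaTerm m hρ hc2 (intCast_add_half_ne N) hcm
  refine ⟨hz, fun ρ hρ => ⟨fun x hx => summable_koshliakovTerm hρ hx, (hS ρ hρ).summable⟩, ?_⟩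
  have hpi : (Real.pi : ℂ) ≠ 0 := ofReal_ne_zero.2 Real.pi_ne_zero
  have hαc : (α : ℂ) ≠ 0 := ofReal_ne_zero.2 hα.ne'
  have hβc : (β : ℂ) ≠ 0 := ofReal_ne_zero.2 hβ.ne'
  set lam : ℝ := α / β with hlam
  have hl : 0 < lam := div_pos hα hβ
  have hla : α ^ 2 / Real.pi ^ 2 = lam := by
    rw [← hαβ, hlam]
    field_simp
  have hlb : β ^ 2 / Real.pi ^ 2 = lam⁻¹ := by
    rw [← hαβ, hlam]
    field_simp
  have hlogα : Real.log (α / Real.pi) = Real.log lam / 2 := by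
    rw [← hla, ← div_pow, Real.log_pow]
    push_cast
    ring
  have hlogβ : Real.log (β / Real.pi) = -(Real.log lam / 2) := by
    have : Real.log (β ^ 2 / Real.pi ^ 2) = 2 * Real.log (β / Real.pi) := by
      rw [← div_pow, Real.log_pow]
      push_cast
      ring
    rw [hlb, Real.log_inv] at this
    linarith
  have hSα := (hS α hα).tsum_eq
  have hSβ := (hS β hβ).tsum_eq
  rw [hla] at hSα
  rw [hlb] at hSβ
  change _ = _ * spectralIntegral m lam c at hSα
  change _ = _ * spectralIntegral m lam⁻¹ c at hSβ
  -- shifting the line of integration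
  set Z : ℂ := riemannZeta (2 * m + 1)
  set D : ℂ := deriv riemannZeta (2 * m + 1)
  set r₀ : ℂ := Z * D - Z ^ 2 * (Real.eulerMascheroniConstant + Real.log lam / 2) with hr₀
  set r₁ : ℂ := (-1) ^ m * (lam : ℂ) ^ (2 * m) *
    (Z ^ 2 * (Real.eulerMascheroniConstant - Real.log lam / 2) - Z * D) with hr₁
  -- `K` counts the integers from `a = -2m - N` to `N`, exactly those crossed by the contour.
  set K : ℕ := (2 * N + 2 * m + 1).toNat with hK
  have hKN : (K : ℤ) = 2 * N + 2 * m + 1 := by omega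
  set a : ℤ := -2 * m - N with ha
  have htel : spectralIntegral m lam c - spectralIntegral m lam (-2 * m - c) =
      2 * Real.pi * ∑ i ∈ Finset.range K, ((if a + i = 0 then r₀ else 0) +
        (if a + i = -2 * m then r₁ else 0) + oddResidue m lam (a + i)) := by
    have h1 := Finset.sum_range_sub
      (fun i : ℕ => spectralIntegral m lam (((a + i : ℤ) : ℝ) - 1 / 2)) K
    have h2 : ((a + (K : ℤ) : ℤ) : ℝ) - 1 / 2 = c := by
      rw [hKN, hc, ha]; push_cast; ring
    have h3 : ((a + ((0 : ℕ) : ℤ) : ℤ) : ℝ) - 1 / 2 = -2 * m - c := by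
      rw [hc, ha]; push_cast; ring
    rw [h2, h3] at h1
    rw [← h1, Finset.mul_sum]
    refine Finset.sum_congr rfl fun i _ => ?_
    rw [← spectralIntegral_sub_eq m hm hl (a + i)]
    congr 2
    push_cast
    ring
  have hmem : ∀ p : ℤ, a ≤ p → p ≤ N → ∃ i ∈ Finset.range K, a + (i : ℤ) = p := by
    intro p h1 h2
    exact ⟨(p - a).toNat, Finset.mem_range.2 (by omega), by omega⟩
  have hite : ∀ (p : ℤ) (r : ℂ), a ≤ p → p ≤ N →
      ∑ i ∈ Finset.range K, (if a + (i : ℤ) = p then r else 0) = r := by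
    intro p r h1 h2
    obtain ⟨i, hi, rfl⟩ := hmem p h1 h2
    rw [Finset.sum_eq_single i (fun j _ hj => if_neg fun h => hj (by omega))
      (fun h => absurd hi h), if_pos rfl]
  -- Reindexing by `p = 1 - 2i`: the surviving odd integers run downwards from `1` to `-2m-1`. There
  -- are `m + 2` of them, and none when `m ≤ -2`.
  have hodd : ∑ i ∈ Finset.range K, oddResidue m lam (a + i) =
      ∑ i ∈ Finset.range (m + 2).toNat, oddResidue m lam (1 - 2 * i) := by
    refine (Finset.sum_of_injOn (fun i : ℕ => (1 - 2 * (i : ℤ) - a).toNat) ?_ ?_ ?_ ?_).symm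
    · intro i hi j hj hij
      have h1 := Finset.mem_range.1 hi
      have h2 := Finset.mem_range.1 hj
      simp only at hij
      omega
    · intro i hi
      have h1 := Finset.mem_range.1 hi
      simp only [Finset.coe_range, Set.mem_Iio]
      omega
    · intro j hj hj'
      by_cases hjo : Odd (a + (j : ℤ))
      · refine oddResidue_eq_zero ?_
        by_contra! h
        obtain ⟨q, hq⟩ := hjo
        refine hj' ⟨(-q).toNat, ?_, ?_⟩
        · simp only [Finset.coe_range, Set.mem_Iio]
          omega
        · simp only
          omega
      · rw [oddResidue, if_neg hjo]
    · intro i hi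
      have h1 := Finset.mem_range.1 hi
      congr 1
      omega
  rw [Finset.sum_add_distrib, Finset.sum_add_distrib, hite 0 r₀ (by omega) (by omega),
    hite (-2 * m) r₁ (by omega) (by omega), hodd, spectralIntegral_reflect m hl c] at htel
  have hfin : (α : ℂ) ^ (-2 * m) * ∑ i ∈ Finset.range (m + 2).toNat, oddResidue m lam (1 - 2 * i) =
      -((2 : ℂ) ^ (4 * m) * Real.pi *
        ∑ i ∈ Finset.range (m + 2).toNat, (dixitGuptaFiniteTerm m α β i : ℂ)) := by
    rw [Finset.mul_sum, Finset.mul_sum, ← Finset.sum_neg_distrib]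
    refine Finset.sum_congr rfl fun i hi => ?_
    have h1 := Finset.mem_range.1 hi
    exact oddResidue_eq_finiteTerm hα hβ hαβ (by omega)
  -- The zeta part of the `α`-bracket is `-r₀`, and that of the `β`-bracket times `(-1)^m λ^(2m)` is
  -- `r₁`, because `log(α/π)` and `log(β/π)` are `±(log λ)/2`. Both double-pole residues are thus
  -- absorbed, and only the odd ones remain.
  have hdiff : dixitGuptaBracket m α - (-1) ^ m * (lam : ℂ) ^ (2 * m) * dixitGuptaBracket m β =
      ∑ i ∈ Finset.range (m + 2).toNat, oddResidue m lam (1 - 2 * i) := by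
    have hA : ∀ x : ℝ, ∀ S : ℂ, Z ^ 2 * ((Real.eulerMascheroniConstant : ℂ) + (x : ℂ) - D / Z) + S =
        Z ^ 2 * (Real.eulerMascheroniConstant + x) - Z * D + S := fun x S => by
      field_simp
    rw [dixitGuptaBracket, dixitGuptaBracket, hSα, hSβ, hlogα, hlogβ, hA, hA]
    have h2 : spectralIntegral m lam c - (-1) ^ m * (lam : ℂ) ^ (2 * m) * spectralIntegral m lam⁻¹ c =
        2 * Real.pi * (r₀ + r₁ +
          ∑ i ∈ Finset.range (m + 2).toNat, oddResidue m lam (1 - 2 * i)) := htel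
    have h3 : (2 * Real.pi : ℂ)⁻¹ * (2 * Real.pi) = 1 :=
      inv_mul_cancel₀ (mul_ne_zero two_ne_zero hpi)
    rw [hr₀, hr₁] at h2
    push_cast
    linear_combination (2 * Real.pi : ℂ)⁻¹ * h2 + (Z * D - Z ^ 2 * (Real.eulerMascheroniConstant + Real.log lam / 2) +
      (-1) ^ m * (lam : ℂ) ^ (2 * m) *
    (Z ^ 2 * (Real.eulerMascheroniConstant - Real.log lam / 2) - Z * D) + ∑ i ∈ Finset.range (m + 2).toNat, oddResidue m lam (1 - 2 * i)) * h3
  have hscale : (α : ℂ) ^ (-2 * m) * (lam : ℂ) ^ (2 * m) = (β : ℂ) ^ (-2 * m) := by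
    rw [hlam, ofReal_div, div_zpow, ← mul_div_assoc, ← zpow_add₀ hαc]
    have : -2 * m + 2 * m = 0 := by ring
    rw [this, zpow_zero, one_div, ← zpow_neg]
    congr 1
    ring
  have hsign : (-1 : ℂ) ^ (-m) = (-1) ^ m := by
    rw [zpow_neg]
    refine inv_eq_of_mul_eq_one_left ?_
    rw [← mul_zpow]
    norm_num
  rw [hsign]
  linear_combination (α : ℂ) ^ (-2 * m) * hdiff + hfin +
    ((-1) ^ m * dixitGuptaBracket m β) * hscale
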